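/- Let $0<\gamma_0\le 0.1$ and $\gamma_1,\gamma_2>0$. Call $f:[-1,1]\to[-1,1]$ an admissible link if it is non-decreasing and is differentiable at every $x\in[1-\gamma_0,1]$ with $\gamma_1\le f'(x)\le\gamma_2$ (derivative relative to $[-1,1]$). Let $d\ge 2$, $\theta^\star\in\mathbb S^{d-1}$, and consider the interactive SGD with learning rates $\eta_t$ and exploration levels $\sigma_t\in[0,1]$: in round $t=1,2,\dots$, given the past, draw $Z_t$ uniformly from $\{a\in\mathbb S^{d-1}:\langle a,\theta_t\rangle=0\}$, play $a_t=\sqrt{1-\sigma_t^2}\,\theta_t+\sigma_tZ_t$, receive $r_t=f(\langle\theta^\star,a_t\rangle)+\xi_t$, where, given the past and $Z_t$, the noise $\xi_t$ has mean zero and is $1$-subGaussian ($\mathbb E e^{\lambda\xi_t}\le e^{\lambda^2/2}$ conditionally, for all $\lambda\in\mathbb R$), and set $$\theta_{t+1/2}=\theta_t-\eta_t\,(f(\langle\theta_t,a_t\rangle)-r_t)\,f'(\langle\theta_t,a_t\rangle)\,(I-\theta_t\theta_t^\top)a_t,\qquad \theta_{t+1}=\theta_{t+1/2}/\|\theta_{t+1/2}\|.$$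 Let $m_t=\langle\theta^\star,\theta_t\rangle$, and suppose that the initialization $\theta_1\in\mathbb S^{d-1}$ satisfies $m_1\ge 1-\gamma_0/4$ (almost surely, if it is random). Then the following hold. 1. (Pure exploration) There are $\sigma\in(0,1]$, $C>0$ and $k\in\mathbb N$ depending only on $\gamma_0,\gamma_1,\gamma_2$ such that for all $d\ge2$ and $\delta>0$ there is a schedule $(\eta_t)_{t\ge1}$, depending only on $d,\delta,\gamma_0,\gamma_1,\gamma_2$, with $$\frac{1}{C L_t}\min\Big\{\frac dt,\frac1d\Big\}\le\eta_t\le C L_t\min\Big\{\frac dt,\frac1d\Big\},\qquad L_t=\log^k\!\Big(e+\frac{dt}{\delta}\Big)\quad(t\ge1),$$ such that, with $\sigma_t=\sigma$ for all $t$, for every admissible link $f$, every $\theta^\star$, every evolution as above, every $\varepsilon>0$ and every integer $T\ge1$ with $T\ge C\,\frac{d^2}{\varepsilon}\log^k\!\big(e+\frac{d}{\varepsilon\delta}\big)$, one has $m_T\ge1-\varepsilon$ with probability at least $1-\delta T$. 2. (Regret minimization) There are $C>0$ and $k\in\mathbb N$ depending only on $\gamma_0,\gamma_1,\gamma_2$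 such that for all $d\ge2$ and $\delta>0$ there are schedules $(\eta_t)_{t\ge1}$ and $(\sigma_t)_{t\ge1}\subset[0,1]$, depending only on $d,\delta,\gamma_0,\gamma_1,\gamma_2$, with $\eta_t$ equal to $\min\{1/\sqrt t,1/d\}$ and $\sigma_t^2$ equal to $\min\{d/\sqrt t,1\}$ up to factors in $[1/(CL_t),\,CL_t]$ for all $t\ge1$ (with $L_t$ as above), such that for every admissible link $f$, every $\theta^\star$, every evolution as above and every integer $T\ge1$, with probability at least $1-\delta T$, $$\sum_{t=1}^T\big(f(1)-f(m_t)\big)\le C\log^k\!\Big(e+\frac{dT}{\delta}\Big)\,d\sqrt T.$$ -/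

import Mathlib

open MeasureTheory Set

noncomputable section

/-- The link functions under consideration: `f : [-1,1] → [-1,1]` is non-decreasing, and on
`[1 - γ₀, 1]` it is differentiable with `γ₁ ≤ f' ≤ γ₂`. Only the values of `f` on `[-1,1]` are
relevant, and the derivative is the one relative to `[-1,1]` (so it is one-sided at `1`). -/
structure IsLink (γ₀ γ₁ γ₂ : ℝ) (f : ℝ → ℝ) : Prop where
  monotone : MonotoneOn f (Icc (-1) 1)
  bounded : MapsTo f (Icc (-1) 1) (Icc (-1) 1)
  differentiable : ∀ x ∈ Icc (1 - γ₀) 1, DifferentiableWithinAt ℝ f (Icc (-1) 1) x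
  le_deriv : ∀ x ∈ Icc (1 - γ₀) 1, γ₁ ≤ derivWithin f (Icc (-1) 1) x
  deriv_le : ∀ x ∈ Icc (1 - γ₀) 1, derivWithin f (Icc (-1) 1) x ≤ γ₂

/-- The uniform distribution on `{a ∈ S^{d-1} : ⟪a, θ⟫ = 0}`: the normalized surface measure of the
unit sphere of the orthogonal complement of `θ`, regarded as a measure on `ℝ^d`. -/
def orthSphereUniform {d : ℕ} (θ : EuclideanSpace ℝ (Fin d)) :
    Measure (EuclideanSpace ℝ (Fin d)) :=
  let ν : Measure (Metric.sphere (0 : (Submodule.span ℝ {θ})ᗮ) 1) :=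
    (volume : Measure (Submodule.span ℝ {θ})ᗮ).toSphere
  (ν univ)⁻¹ • ν.map (fun z => z.1.1)

/-- The action `√(1 - σ²) θ + σ z`. -/
def sgdAction {d : ℕ} (σ : ℝ) (θ z : EuclideanSpace ℝ (Fin d)) : EuclideanSpace ℝ (Fin d) :=
  √(1 - σ ^ 2) • θ + σ • z

/-- The unnormalized descent step
`θ - η (f ⟪θ, a⟫ - r) f' ⟪θ, a⟫ (I - θ θᵀ) a`. -/
def sgdHalfStep {d : ℕ} (f : ℝ → ℝ) (η : ℝ) (θ a : EuclideanSpace ℝ (Fin d)) (r : ℝ) :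
    EuclideanSpace ℝ (Fin d) :=
  θ - (η * (f (inner ℝ θ a) - r) * derivWithin f (Icc (-1) 1) (inner ℝ θ a)) •
    (a - inner ℝ θ a • θ)

/-- The spherical SGD update: a descent step followed by normalization. -/
def sgdStep {d : ℕ} (f : ℝ → ℝ) (η : ℝ) (θ a : EuclideanSpace ℝ (Fin d)) (r : ℝ) :
    EuclideanSpace ℝ (Fin d) :=
  ‖sgdHalfStep f η θ a r‖⁻¹ • sgdHalfStep f η θ a r

/-- The interactive SGD evolution in rounds `t = 1, 2, …`, with true parameter `θs`, learning rates
`η t` and exploration levels `σ t`. The σ-algebra `𝓕 t` is the information available at the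
beginning of round `t`. In round `t`, the direction `Z t` is drawn uniformly from the unit vectors
orthogonal to `θ t`, the action is `a = √(1 - σ²) θ t + σ Z t`, the reward is `f ⟪θs, a⟫ + ξ t`, and
`θ (t + 1)` is the result of the SGD update. Given `𝓕 t` and `Z t`, the noise `ξ t` has mean zero
and is `1`-subGaussian. -/
structure IsInteractiveSGD {d : ℕ} {Ω : Type*} [mΩ : MeasurableSpace Ω] (μ : Measure Ω)
    (𝓕 : Filtration ℕ mΩ) (f : ℝ → ℝ) (θs : EuclideanSpace ℝ (Fin d)) (η σ : ℕ → ℝ)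
    (θ Z : ℕ → Ω → EuclideanSpace ℝ (Fin d)) (ξ : ℕ → Ω → ℝ) : Prop where
  norm_init : ∀ ω, ‖θ 1 ω‖ = 1
  measurable_param : ∀ t, 1 ≤ t → Measurable[𝓕 t] (θ t)
  measurable_dir : ∀ t, 1 ≤ t → Measurable[𝓕 (t + 1)] (Z t)
  measurable_noise : ∀ t, 1 ≤ t → Measurable[𝓕 (t + 1)] (ξ t)
  /-- the conditional distribution of `Z t` given `𝓕 t` -/
  law_dir : ∀ t, 1 ≤ t → ∀ A : Set Ω, MeasurableSet[𝓕 t] A →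
    ∀ S : Set (EuclideanSpace ℝ (Fin d)), MeasurableSet S →
      μ (A ∩ Z t ⁻¹' S) = ∫⁻ ω in A, orthSphereUniform (θ t ω) S ∂μ
  noise_mean : ∀ t, 1 ≤ t →
    μ[ξ t | 𝓕 t ⊔ MeasurableSpace.comap (Z t) inferInstance] =ᵐ[μ] 0
  noise_integrable : ∀ t, 1 ≤ t → ∀ l : ℝ, Integrable (fun ω => Real.exp (l * ξ t ω)) μ
  noise_subgaussian : ∀ t, 1 ≤ t → ∀ l : ℝ,
    μ[fun ω => Real.exp (l * ξ t ω) | 𝓕 t ⊔ MeasurableSpace.comap (Z t) inferInstance]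
      ≤ᵐ[μ] fun _ => Real.exp (l ^ 2 / 2)
  update : ∀ t, 1 ≤ t → ∀ ω,
    θ (t + 1) ω = sgdStep f (η t) (θ t ω) (sgdAction (σ t) (θ t ω) (Z t ω))
      (f (inner ℝ θs (sgdAction (σ t) (θ t ω) (Z t ω))) + ξ t ω)

/-- The factor `log^k (e + x)`, at least `1` for `x ≥ 0`. -/
def polylog (k : ℕ) (x : ℝ) : ℝ := Real.log (Real.exp 1 + x) ^ k

/-- `x` equals `y` up to the constant factor `C` and the poly-logarithmic factor `ℓ`. -/
def ThetaWithin (C ℓ x y : ℝ) : Prop := y / (C * ℓ) ≤ x ∧ x ≤ C * ℓ * y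

end

/-!
The loss of the current parameter is `Δ t = 1 - ⟪θs, θ t⟫`. Write `v = ⟪θs, Z t⟫`,
`q = σ t * f' (√(1 - σ t ^ 2))`, and let `R` be the difference between the reward and the baseline
`f (√(1 - σ t ^ 2))`. The update moves `θ t` by `η t * q * R` in the direction `Z t` and
normalizes. Normalization costs at most `√(1 + (η q R)²) - 1`, so the loss changes by at most
`- η q R v + (√(1 + (η q R)²) - 1)`.

The conditional mean of `v R` is at least `γ₁ σ E v²`: the noise is centred, replacing the baseline
by `f` at the centre `√(1 - σ t ^ 2) * ⟪θs, θ t⟫` costs nothing because `v` is centred given the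
past, and near `1` the link grows at rate at least `γ₁`. As `Z t` is uniform on the unit sphere of a
space of dimension `d - 1`, `E v² = (1 - ⟪θs, θ t⟫²) / (d - 1) ≥ Δ t / d`. Hence the drift contracts
the loss by the factor `1 - γ₁² η σ² / (2 d)`, up to a second order term of size `η² σ²`.

For concentration, this is carried out for the exponential `exp (l t * Δ t)` with `l t` of order
`1 / η t` (`exp_normalized_le`, `exp_sgdStep_le`, `round_exp_moment_le`). The variance of the linear
term is proportional to `v²`, so it is absorbed in the contraction when `l t * η t` is a small
constant, and the terms coming from the normalization are controlled by `E exp (± 2 ξ)` alone.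
If `l (t + 1) * (1 - γ₁² η σ² / (2 d)) ≤ l t`, the exponential moment, restricted to the event that
the loss was below `b s` in all rounds `s ≤ t`, grows only by the second order terms. Markov's
inequality then bounds the probability of leaving the confidence region in any given round by `δ`
(`IsInteractiveSGD.confined`), and a union bound gives `1 - δ T`.

Both parts use schedules with `η t * σ t ^ 2 = 2 d / (γ₁² N)`, where `N = t + (M d ℓ)²` and
`ℓ = log (e + d / δ)`: constant `σ` and `η` of order `d / N` for pure exploration, and `η` of order
`1 / √N`, `σ²` of order `d / √N` for regret minimization. The contraction factor of a round is then
`1 - 1 / N`, which suffices for `l t = c / η t`, and the second order terms add up to `d` times a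
logarithm. The shift `(M d ℓ)²` keeps the confidence bound below `γ₀ / 2` at all times. The bound is
of order `d² / t` in the first case and `d / √t` in the second, up to logarithms.
-/

open MeasureTheory Set

/-! ### The uniform distribution on the sphere of a Euclidean space -/

section UniformSphere

variable {E : Type*} [NormedAddCommGroup E] [InnerProductSpace ℝ E] [FiniteDimensional ℝ E]
  [MeasurableSpace E] [BorelSpace E]

/-- The uniform probability measure on the unit sphere of `E`, regarded as a measure on `E`. -/
noncomputable def uniformSphere (E : Type*) [NormedAddCommGroup E] [InnerProductSpace ℝ E]
    [FiniteDimensional ℝ E] [MeasurableSpace E] [BorelSpace E] : Measure E :=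
  ((volume : Measure E).toSphere univ)⁻¹ •
    (volume : Measure E).toSphere.map (Subtype.val : Metric.sphere (0 : E) 1 → E)

instance isProbabilityMeasure_uniformSphere [Nontrivial E] :
    IsProbabilityMeasure (uniformSphere E) := by
  constructor
  have h0 : (volume : Measure E).toSphere univ ≠ 0 := by
    rw [Ne, Measure.measure_univ_eq_zero]
    exact (volume : Measure E).toSphere_ne_zero
  simp only [uniformSphere, Measure.smul_apply, smul_eq_mul]
  rw [Measure.map_apply measurable_subtype_coe .univ, preimage_univ]
  exact ENNReal.inv_mul_cancel h0 (measure_ne_top _ _)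

lemma norm_ae_uniformSphere : ∀ᵐ z ∂(uniformSphere E), ‖z‖ = 1 := by
  refine Measure.ae_smul_measure ?_ _
  rw [ae_map_iff measurable_subtype_coe.aemeasurable
    (measurableSet_eq_fun measurable_norm measurable_const)]
  exact .of_forall fun z => by simp

/-- The uniform measure on the sphere is invariant under linear isometries, because the cone over
the image of a set is the image of the cone over that set. -/
lemma map_uniformSphere (L : E ≃ₗᵢ[ℝ] E) : (uniformSphere E).map L = uniformSphere E := by
  have hL : Measurable L := L.continuous.measurable
  simp only [uniformSphere, Measure.map_smul]
  congr 1
  ext S hS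
  rw [Measure.map_apply hL hS, Measure.map_apply measurable_subtype_coe (hL hS),
    Measure.map_apply measurable_subtype_coe hS,
    Measure.toSphere_apply' _ (measurable_subtype_coe (hL hS)),
    Measure.toSphere_apply' _ (measurable_subtype_coe hS)]
  congr 1
  rw [← L.symm.measurePreserving.measure_preimage_equiv (f := L.symm.toMeasurableEquiv)]
  congr 1
  ext x
  simp only [mem_smul, Set.mem_image, mem_preimage, Subtype.exists]
  constructor
  · rintro ⟨r, hr, _, ⟨z, hz, hzS, rfl⟩, h⟩
    have h' : r • z = L.symm x := h
    refine ⟨r, hr, L z, ⟨L z, by simpa using hz, hzS, rfl⟩, ?_⟩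
    rw [← L.map_smul, h', L.apply_symm_apply]
  · rintro ⟨r, hr, _, ⟨z, hz, hzS, rfl⟩, rfl⟩
    refine ⟨r, hr, L.symm z, ⟨L.symm z, by simpa using hz, by simpa using hzS, rfl⟩, ?_⟩
    exact (L.symm.map_smul r z).symm

lemma integral_inner_uniformSphere (u : E) : ∫ z, inner ℝ u z ∂(uniformSphere E) = 0 := by
  have h : ∫ z, inner ℝ u z ∂(uniformSphere E) = ∫ z, -inner ℝ u z ∂(uniformSphere E) := by
    conv_lhs => rw [← map_uniformSphere (LinearIsometryEquiv.neg ℝ)]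
    rw [integral_map (LinearIsometryEquiv.continuous _).measurable.aemeasurable
      (by fun_prop)]
    simp
  rw [integral_neg] at h
  linarith

lemma integrable_inner_sq_uniformSphere [Nontrivial E] (u : E) :
    Integrable (fun z => inner ℝ u z ^ 2) (uniformSphere E) := by
  refine Integrable.of_bound (by fun_prop) (‖u‖ ^ 2) ?_
  filter_upwards [norm_ae_uniformSphere] with z hz
  have := abs_real_inner_le_norm u z
  rw [hz, mul_one] at this
  rw [Real.norm_eq_abs, abs_pow]
  gcongr

/-- The second moment in direction `u` only depends on the length of `u`, and the second moments in
the directions of an orthonormal basis add up to `1`. -/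
lemma integral_inner_sq_uniformSphere [Nontrivial E] (u : E) :
    ∫ z, inner ℝ u z ^ 2 ∂(uniformSphere E) = ‖u‖ ^ 2 / Module.finrank ℝ E := by
  -- Vectors of the same length are exchanged by a reflection.
  have key (v w : E) (h : ‖v‖ = ‖w‖) :
      ∫ z, inner ℝ v z ^ 2 ∂(uniformSphere E) = ∫ z, inner ℝ w z ^ 2 ∂(uniformSphere E) := by
    set L : E ≃ₗᵢ[ℝ] E := (Submodule.span ℝ {v - w})ᗮ.reflection
    have hL : L v = w := Submodule.reflection_sub h
    conv_rhs => rw [← map_uniformSphere L]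
    rw [integral_map L.continuous.measurable.aemeasurable (by fun_prop)]
    simp [← hL, L.inner_map_map]
  let b := stdOrthonormalBasis ℝ E
  have hn : (Module.finrank ℝ E : ℝ) ≠ 0 := by
    exact_mod_cast Module.finrank_pos.ne'
  have hsum : ∑ i, ∫ z, inner ℝ (‖u‖ • b i) z ^ 2 ∂(uniformSphere E) = ‖u‖ ^ 2 := by
    rw [← integral_finsetSum _ fun i _ => integrable_inner_sq_uniformSphere _]
    calc _ = ∫ z, ‖u‖ ^ 2 ∂(uniformSphere E) := by
          refine integral_congr_ae ?_
          filter_upwards [norm_ae_uniformSphere] with z hz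
          have := b.sum_sq_norm_inner_right z
          simp only [Real.norm_eq_abs, sq_abs, hz] at this
          simp only [real_inner_smul_left, mul_pow, ← Finset.mul_sum, this]
          simp
      _ = ‖u‖ ^ 2 := by simp
  have hconst (i) : ∫ z, inner ℝ (‖u‖ • b i) z ^ 2 ∂(uniformSphere E)
      = ∫ z, inner ℝ u z ^ 2 ∂(uniformSphere E) :=
    key _ _ (by simp [norm_smul])
  simp only [hconst, Finset.sum_const, Finset.card_univ, Fintype.card_fin, nsmul_eq_mul] at hsum
  rw [← hsum]
  field_simp

end UniformSphere

section OrthSphere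

variable {d : ℕ}

lemma orthSphereUniform_eq_map (θ : EuclideanSpace ℝ (Fin d)) :
    orthSphereUniform θ = (uniformSphere (Submodule.span ℝ {θ})ᗮ).map Subtype.val := by
  simp only [orthSphereUniform, uniformSphere, Measure.map_smul]
  rw [Measure.map_map measurable_subtype_coe measurable_subtype_coe]
  rfl

lemma finrank_orthogonal_span {θ : EuclideanSpace ℝ (Fin d)} (hθ : ‖θ‖ = 1) :
    Module.finrank ℝ (Submodule.span ℝ {θ})ᗮ + 1 = d := by
  have h0 : θ ≠ 0 := by rintro rfl; simp at hθ
  have := Submodule.finrank_add_finrank_orthogonal (Submodule.span ℝ {θ})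
  rw [finrank_span_singleton h0, finrank_euclideanSpace_fin] at this
  omega

lemma nontrivial_orthogonal_span (hd : 2 ≤ d) {θ : EuclideanSpace ℝ (Fin d)} (hθ : ‖θ‖ = 1) :
    Nontrivial (Submodule.span ℝ {θ})ᗮ := by
  have := finrank_orthogonal_span hθ
  exact Module.nontrivial_of_finrank_pos (R := ℝ) (by omega)

lemma isProbabilityMeasure_orthSphereUniform (hd : 2 ≤ d) {θ : EuclideanSpace ℝ (Fin d)}
    (hθ : ‖θ‖ = 1) : IsProbabilityMeasure (orthSphereUniform θ) := by
  have := nontrivial_orthogonal_span hd hθ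
  rw [orthSphereUniform_eq_map]
  exact Measure.isProbabilityMeasure_map measurable_subtype_coe.aemeasurable

lemma ae_orthSphereUniform (θ : EuclideanSpace ℝ (Fin d)) :
    ∀ᵐ z ∂(orthSphereUniform θ), ‖z‖ = 1 ∧ inner ℝ θ z = 0 := by
  have hS : MeasurableSet {z : EuclideanSpace ℝ (Fin d) | ‖z‖ = 1 ∧ inner ℝ θ z = 0} :=
    (measurableSet_eq_fun measurable_norm measurable_const).inter
      (measurableSet_eq_fun (by fun_prop) measurable_const)
  rw [orthSphereUniform_eq_map, ae_map_iff measurable_subtype_coe.aemeasurable hS]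
  filter_upwards [norm_ae_uniformSphere] with z hz
  exact ⟨hz, Submodule.mem_orthogonal_singleton_iff_inner_right.1 z.2⟩

lemma integral_inner_orthSphereUniform (θ u : EuclideanSpace ℝ (Fin d)) :
    ∫ z, inner ℝ u z ∂(orthSphereUniform θ) = 0 := by
  rw [orthSphereUniform_eq_map, integral_map measurable_subtype_coe.aemeasurable (by fun_prop)]
  rw [← integral_inner_uniformSphere ((Submodule.span ℝ {θ})ᗮ.orthogonalProjectionOnto u)]
  refine integral_congr_ae (.of_forall fun z => ?_)
  simp

lemma integral_inner_sq_orthSphereUniform (hd : 2 ≤ d) {θ : EuclideanSpace ℝ (Fin d)}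
    (hθ : ‖θ‖ = 1) (u : EuclideanSpace ℝ (Fin d)) :
    ∫ z, inner ℝ u z ^ 2 ∂(orthSphereUniform θ)
      = (‖u‖ ^ 2 - inner ℝ u θ ^ 2) / ((d : ℝ) - 1) := by
  have := nontrivial_orthogonal_span hd hθ
  have hfin : (Module.finrank ℝ (Submodule.span ℝ {θ})ᗮ : ℝ) = (d : ℝ) - 1 := by
    have := finrank_orthogonal_span hθ
    rw [eq_sub_iff_add_eq]; exact_mod_cast this
  have hproj : ‖(Submodule.span ℝ {θ})ᗮ.orthogonalProjectionOnto u‖ ^ 2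
      = ‖u‖ ^ 2 - inner ℝ u θ ^ 2 := by
    have h := Submodule.norm_sq_eq_add_norm_sq_projection u (Submodule.span ℝ {θ})
    have h1 : ‖(Submodule.span ℝ {θ}).orthogonalProjectionOnto u‖ = |inner ℝ u θ| := by
      rw [← Submodule.norm_coe, ← Submodule.starProjection_apply,
        Submodule.starProjection_unit_singleton ℝ hθ, norm_smul, hθ, mul_one, Real.norm_eq_abs,
        real_inner_comm]
    rw [h1, sq_abs] at h
    linarith
  rw [orthSphereUniform_eq_map, integral_map measurable_subtype_coe.aemeasurable (by fun_prop),
    ← hfin, ← hproj, ← integral_inner_sq_uniformSphere]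
  refine integral_congr_ae (.of_forall fun z => ?_)
  simp

end OrthSphere

/-! ### Exploration directions with a prescribed conditional law -/

section ConditionalDirection

variable {d : ℕ} {Ω : Type*} {m : MeasurableSpace Ω} [mΩ : MeasurableSpace Ω]
  {μ : Measure Ω}
  {θ Z : Ω → EuclideanSpace ℝ (Fin d)}

/-- Given `m`, the vector `Z` is uniformly distributed on the unit vectors orthogonal to `θ`. -/
def IsUniformOrth (μ : Measure Ω) (m : MeasurableSpace Ω)
    (θ Z : Ω → EuclideanSpace ℝ (Fin d)) : Prop :=
  ∀ A : Set Ω, MeasurableSet[m] A → ∀ S : Set (EuclideanSpace ℝ (Fin d)), MeasurableSet S →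
    μ (A ∩ Z ⁻¹' S) = ∫⁻ ω in A, orthSphereUniform (θ ω) S ∂μ

/-- Disintegration, as an inequality. It needs no measurability of `θ ↦ orthSphereUniform θ`,
because the lower integral is superadditive. -/
lemma IsUniformOrth.setLIntegral_le (h : IsUniformOrth μ m θ Z) (hZ : Measurable Z)
    {A : Set Ω} (hA : MeasurableSet[m] A) {ψ : EuclideanSpace ℝ (Fin d) → ENNReal}
    (hψ : Measurable ψ) :
    ∫⁻ ω in A, ψ (Z ω) ∂μ ≤ ∫⁻ ω in A, ∫⁻ z, ψ z ∂(orthSphereUniform (θ ω)) ∂μ := by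
  refine Measurable.ennreal_induction (motive := fun ψ => ∫⁻ ω in A, ψ (Z ω) ∂μ
    ≤ ∫⁻ ω in A, ∫⁻ z, ψ z ∂(orthSphereUniform (θ ω)) ∂μ) (fun c S hS => ?_)
    (fun f g _ hf hg ihf ihg => ?_) (fun f hf hmono ih => ?_) hψ
  · have e1 (ω : Ω) : S.indicator (fun _ => c) (Z ω) = (Z ⁻¹' S).indicator (fun _ => c) ω := rfl
    simp only [e1, lintegral_indicator_const hS, lintegral_indicator_const (hZ hS)]
    rw [Measure.restrict_apply (hZ hS), inter_comm, h A hA S hS]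
    exact lintegral_const_mul_le _ _
  · simp only [Pi.add_apply, lintegral_add_left hf]
    rw [lintegral_add_left (f := fun ω => f (Z ω)) (hf.comp hZ)]
    exact (add_le_add ihf ihg).trans (le_lintegral_add _ _)
  · beta_reduce
    rw [lintegral_iSup (f := fun n ω => f n (Z ω)) (fun n => (hf n).comp hZ)
      fun i j hij ω => hmono hij (Z ω)]
    refine iSup_le fun n => (ih n).trans (lintegral_mono fun ω => lintegral_mono fun z => ?_)
    exact le_iSup (fun i => f i z) n

/-- An open condition on `(θ, Z)` that has conditional probability zero almost surely fails:
an open set is a countable union of rectangles. -/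
lemma IsUniformOrth.ae_notMem (h : IsUniformOrth μ m θ Z) (hθ : Measurable[m] θ)
    {U : Set (EuclideanSpace ℝ (Fin d) × EuclideanSpace ℝ (Fin d))} (hU : IsOpen U)
    (hU0 : ∀ x, orthSphereUniform x {z | (x, z) ∈ U} = 0) :
    ∀ᵐ ω ∂μ, (θ ω, Z ω) ∉ U := by
  let B := TopologicalSpace.countableBasis (EuclideanSpace ℝ (Fin d))
  have hB := TopologicalSpace.isBasis_countableBasis (EuclideanSpace ℝ (Fin d))
  have hcount : (B ×ˢ B : Set _).Countable :=
    (TopologicalSpace.countable_countableBasis _).prod (TopologicalSpace.countable_countableBasis _)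
  have hnull : ∀ p ∈ B ×ˢ B, ∀ᵐ ω ∂μ, p.1 ×ˢ p.2 ⊆ U → ¬ (θ ω ∈ p.1 ∧ Z ω ∈ p.2) := by
    rintro ⟨V, W⟩ ⟨hV, hW⟩
    by_cases hVW : V ×ˢ W ⊆ U
    · have hV' : MeasurableSet V := (hB.isOpen hV).measurableSet
      have hW' : MeasurableSet W := (hB.isOpen hW).measurableSet
      have h0 : μ (θ ⁻¹' V ∩ Z ⁻¹' W) = 0 := by
        rw [h _ (hθ hV') _ hW']
        refine nonpos_iff_eq_zero.1 ((setLIntegral_mono_ae (g := fun _ => 0) (by fun_prop)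
          (.of_forall fun ω hω => ?_)).trans (by simp))
        rw [← hU0 (θ ω)]
        exact measure_mono fun z hz => hVW ⟨hω, hz⟩
      filter_upwards [measure_eq_zero_iff_ae_notMem.1 h0] with ω hω _ hc
      exact hω hc
    · exact .of_forall fun ω hc => absurd hc hVW
  filter_upwards [(ae_ball_iff hcount).2 hnull] with ω hω hmem
  obtain ⟨p, hp, hp1, hp2⟩ := (hB.prod hB).exists_subset_of_mem_open hmem hU
  obtain ⟨V, hV, W, hW, rfl⟩ := hp
  exact hω (V, W) ⟨hV, hW⟩ hp2 hp1

lemma IsUniformOrth.ae_norm_inner (h : IsUniformOrth μ m θ Z) (hθ : Measurable[m] θ) :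
    ∀ᵐ ω ∂μ, ‖Z ω‖ = 1 ∧ inner ℝ (θ ω) (Z ω) = 0 := by
  have hU : IsOpen {p : EuclideanSpace ℝ (Fin d) × EuclideanSpace ℝ (Fin d) |
      ¬ (‖p.2‖ = 1 ∧ inner ℝ p.1 p.2 = 0)} := by
    rw [← isClosed_compl_iff]
    simp only [compl_ofPred, not_not]
    exact (isClosed_eq (by fun_prop) (by fun_prop)).inter
      (isClosed_eq (by fun_prop) (by fun_prop))
  filter_upwards [h.ae_notMem hθ hU fun x => ae_iff.1 (ae_orthSphereUniform x)] with ω hω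
  exact not_not.1 hω

variable [IsProbabilityMeasure μ]

/-- Real-valued version of the disintegration inequality. Applied to `ψ` and to `-ψ`, it gives the
conditional expectation of `ψ (Z ω)`. -/
lemma IsUniformOrth.setIntegral_le (h : IsUniformOrth μ m θ Z) (hd : 2 ≤ d)
    (hθ : Measurable[m] θ) (hθ1 : ∀ᵐ ω ∂μ, ‖θ ω‖ = 1) (hZ : Measurable Z)
    {ψ : EuclideanSpace ℝ (Fin d) → ℝ} (hψ : Measurable ψ) {K : ℝ}
    (hK : ∀ z, ‖z‖ = 1 → |ψ z| ≤ K) {g : Ω → ℝ} (hg : Measurable g)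
    (hgψ : ∀ᵐ ω ∂μ, ∫ z, ψ z ∂(orthSphereUniform (θ ω)) = g ω)
    {A : Set Ω} (hA : MeasurableSet[m] A) :
    ∫ ω in A, ψ (Z ω) ∂μ ≤ ∫ ω in A, g ω ∂μ := by
  have hψZ : ∀ᵐ ω ∂(μ.restrict A), |ψ (Z ω)| ≤ K :=
    ae_restrict_of_ae ((h.ae_norm_inner hθ).mono fun ω hω => hK _ hω.1)
  have hν : ∀ᵐ ω ∂(μ.restrict A),
      ∫⁻ z, ENNReal.ofReal (ψ z + K) ∂(orthSphereUniform (θ ω)) = ENNReal.ofReal (g ω + K)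
        ∧ |g ω| ≤ K := by
    refine ae_restrict_of_ae ?_
    filter_upwards [hθ1, hgψ] with ω h1 h2
    have := isProbabilityMeasure_orthSphereUniform hd h1
    have hb : ∀ᵐ z ∂(orthSphereUniform (θ ω)), ‖ψ z‖ ≤ K :=
      (ae_orthSphereUniform _).mono fun z hz => hK z hz.1
    have hi : Integrable ψ (orthSphereUniform (θ ω)) :=
      Integrable.of_bound hψ.aestronglyMeasurable K hb
    constructor
    -- the function is shifted by `K` to make it nonnegative
    · have e := ofReal_integral_eq_lintegral_ofReal (f := fun z => ψ z + K)
        (hi.add (integrable_const K)) ?_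
      · rw [← e, integral_add hi (integrable_const K), h2]
        simp
      · filter_upwards [hb] with z hz
        have := (abs_le.1 hz).1
        simp only [Pi.zero_apply]; linarith
    · rw [← h2]
      simpa using norm_integral_le_of_norm_le_const hb
  have hi1 : Integrable (fun ω => ψ (Z ω)) (μ.restrict A) :=
    Integrable.of_bound (hψ.comp hZ).aestronglyMeasurable K hψZ
  have hi2 : Integrable g (μ.restrict A) :=
    Integrable.of_bound hg.aestronglyMeasurable K (hν.mono fun ω hω => hω.2)
  have key := h.setLIntegral_le hZ hA (ψ := fun z => ENNReal.ofReal (ψ z + K)) (by fun_prop)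
  rw [lintegral_congr_ae (hν.mono fun ω hω => hω.1),
    ← ofReal_integral_eq_lintegral_ofReal (f := fun ω => ψ (Z ω) + K)
      (hi1.add (integrable_const K)) ?_,
    ← ofReal_integral_eq_lintegral_ofReal (f := fun ω => g ω + K)
      (hi2.add (integrable_const K)) ?_,
    ENNReal.ofReal_le_ofReal_iff, integral_add hi1 (integrable_const K),
    integral_add hi2 (integrable_const K)] at key
  · linarith
  · refine integral_nonneg_of_ae ?_
    filter_upwards [hν] with ω hω
    have := (abs_le.1 hω.2).1
    simp only [Pi.zero_apply]; linarith
  · filter_upwards [hν] with ω hω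
    have := (abs_le.1 hω.2).1
    simp only [Pi.zero_apply]; linarith
  · filter_upwards [hψZ] with ω hω
    have := (abs_le.1 hω).1
    simp only [Pi.zero_apply]; linarith

/-- The conditional expectation of a function of `Z` is its integral against the conditional
law. -/
lemma IsUniformOrth.condExp_eq (h : IsUniformOrth μ m θ Z) (hm : m ≤ mΩ) (hd : 2 ≤ d)
    (hθ : Measurable[m] θ) (hθ1 : ∀ᵐ ω ∂μ, ‖θ ω‖ = 1) (hZ : Measurable Z)
    {ψ : EuclideanSpace ℝ (Fin d) → ℝ} (hψ : Measurable ψ) {K : ℝ}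
    (hK : ∀ z, ‖z‖ = 1 → |ψ z| ≤ K) {g : Ω → ℝ} (hg : Measurable[m] g)
    (hgψ : ∀ᵐ ω ∂μ, ∫ z, ψ z ∂(orthSphereUniform (θ ω)) = g ω) :
    μ[fun ω => ψ (Z ω) | m] =ᵐ[μ] g := by
  have hψZ : ∀ᵐ ω ∂μ, ‖ψ (Z ω)‖ ≤ K := (h.ae_norm_inner hθ).mono fun ω hω => hK _ hω.1
  have hgK : ∀ᵐ ω ∂μ, ‖g ω‖ ≤ K := by
    filter_upwards [hθ1, hgψ] with ω h1 h2
    have := isProbabilityMeasure_orthSphereUniform hd h1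
    rw [← h2]
    simpa using norm_integral_le_of_norm_le_const (f := ψ) (C := K)
      ((ae_orthSphereUniform (θ ω)).mono fun z hz => hK z hz.1)
  have hg' : Measurable g := hg.mono hm le_rfl
  refine (ae_eq_condExp_of_forall_setIntegral_eq hm
    (Integrable.of_bound (hψ.comp hZ).aestronglyMeasurable K hψZ)
    (fun s _ _ => (Integrable.of_bound hg'.aestronglyMeasurable K hgK).integrableOn)
    (fun s hs _ => le_antisymm ?_ ?_) (hg.stronglyMeasurable.aestronglyMeasurable)).symm
  · have := h.setIntegral_le hd hθ hθ1 hZ hψ.neg (K := K) (by simpa using hK) hg'.neg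
      (by filter_upwards [hgψ] with ω hω; simp [integral_neg, hω]) hs
    simp only [Pi.neg_apply, integral_neg] at this
    exact neg_le_neg_iff.1 this
  · exact h.setIntegral_le hd hθ hθ1 hZ hψ hK hg' hgψ hs

lemma IsUniformOrth.condExp_inner (h : IsUniformOrth μ m θ Z) (hm : m ≤ mΩ) (hd : 2 ≤ d)
    (hθ : Measurable[m] θ) (hθ1 : ∀ᵐ ω ∂μ, ‖θ ω‖ = 1) (hZ : Measurable Z)
    (u : EuclideanSpace ℝ (Fin d)) :
    μ[fun ω => inner ℝ u (Z ω) | m] =ᵐ[μ] 0 :=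
  h.condExp_eq hm hd hθ hθ1 hZ (ψ := fun z => inner ℝ u z) (by fun_prop) (K := ‖u‖)
    (fun z hz => by simpa [hz] using abs_real_inner_le_norm u z) measurable_const
    (.of_forall fun _ => integral_inner_orthSphereUniform _ _)

lemma IsUniformOrth.condExp_inner_sq (h : IsUniformOrth μ m θ Z) (hm : m ≤ mΩ) (hd : 2 ≤ d)
    (hθ : Measurable[m] θ) (hθ1 : ∀ᵐ ω ∂μ, ‖θ ω‖ = 1) (hZ : Measurable Z)
    (u : EuclideanSpace ℝ (Fin d)) :
    μ[fun ω => inner ℝ u (Z ω) ^ 2 | m]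
      =ᵐ[μ] fun ω => (‖u‖ ^ 2 - inner ℝ u (θ ω) ^ 2) / ((d : ℝ) - 1) := by
  refine h.condExp_eq hm hd hθ hθ1 hZ (ψ := fun z => inner ℝ u z ^ 2) (by fun_prop) (K := ‖u‖ ^ 2)
    (fun z hz => ?_) ?_ ?_
  · have := abs_real_inner_le_norm u z
    rw [hz, mul_one] at this
    rw [abs_pow]; gcongr
  · have : Measurable[m] fun ω => inner ℝ u (θ ω) :=
      (by fun_prop : Measurable fun z : EuclideanSpace ℝ (Fin d) => inner ℝ u z).comp hθ
    exact ((this.pow_const 2).const_sub _).div_const _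
  · filter_upwards [hθ1] with ω hω
    exact integral_inner_sq_orthSphereUniform hd hω u

end ConditionalDirection

/-! ### Integration against conditional expectations -/

section CondExpMul

variable {Ω : Type*} {m : MeasurableSpace Ω} [mΩ : MeasurableSpace Ω] {μ : Measure Ω}
  [IsProbabilityMeasure μ] {X Y : Ω → ℝ} {K : ℝ}

lemma integral_mul_condExp (hm : m ≤ mΩ) (hX : Measurable[m] X) (hXK : ∀ᵐ ω ∂μ, |X ω| ≤ K)
    (hY : Integrable Y μ) :
    ∫ ω, X ω * Y ω ∂μ = ∫ ω, X ω * (μ[Y | m]) ω ∂μ := by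
  have hXY : Integrable (X * Y) μ :=
    hY.bdd_mul (hX.mono hm le_rfl).aestronglyMeasurable hXK
  rw [← integral_condExp hm (f := fun ω => X ω * Y ω)]
  exact integral_congr_ae (condExp_mul_of_stronglyMeasurable_left hX.stronglyMeasurable hXY hY)

end CondExpMul

/-! ### Exponential bound for one normalized step -/

section OneStep

lemma exp_le_one_add_add_sq_mul_exp_abs (z : ℝ) :
    Real.exp z ≤ 1 + z + z ^ 2 * Real.exp |z| := by
  rcases le_total 0 z with hz | hz
  · have h1 : 1 - z ≤ Real.exp (-z) := by linarith [Real.add_one_le_exp (-z)]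
    have h2 : Real.exp z * Real.exp (-z) = 1 := by rw [← Real.exp_add]; simp
    have h3 : Real.exp z - 1 ≤ z * Real.exp z := by
      nlinarith [mul_le_mul_of_nonneg_left h1 (Real.exp_pos z).le]
    rw [abs_of_nonneg hz]
    nlinarith [mul_le_mul_of_nonneg_left h3 hz]
  · have h1 : 1 - z ≤ Real.exp (-z) := by linarith [Real.add_one_le_exp (-z)]
    have h2 : Real.exp z * Real.exp (-z) = 1 := by rw [← Real.exp_add]; simp
    have h3 : Real.exp z * (1 - z) ≤ 1 := by
      nlinarith [mul_le_mul_of_nonneg_left h1 (Real.exp_pos z).le]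
    have h4 : 1 ≤ Real.exp |z| := Real.one_le_exp (abs_nonneg z)
    have h5 : Real.exp z ≤ 1 + z + z ^ 2 := by
      have : (1 - z) * Real.exp z ≤ (1 - z) * (1 + z + z ^ 2) := by
        nlinarith [pow_nonneg (neg_nonneg.2 hz) 3]
      exact le_of_mul_le_mul_left this (by linarith)
    nlinarith [sq_nonneg z]

/-- Normalizing a vector of length `√(1 + x²)` costs at most `√(1 + x²) - 1` of its correlation
with a unit vector, as that correlation is at most `√(1 + x²)`. -/
lemma one_sub_normalized_le {m v x : ℝ} (h : m ^ 2 + v ^ 2 ≤ 1) :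
    1 - (√(1 + x ^ 2))⁻¹ * (m + x * v) ≤ 1 - m - x * v + (√(1 + x ^ 2) - 1) := by
  have hS : 1 ≤ √(1 + x ^ 2) := Real.one_le_sqrt.2 (by nlinarith [sq_nonneg x])
  have hle : m + x * v ≤ √(1 + x ^ 2) := by
    refine Real.le_sqrt_of_sq_le ?_
    nlinarith [sq_nonneg (m * x - v), sq_nonneg x]
  have hinv : (√(1 + x ^ 2))⁻¹ * √(1 + x ^ 2) = 1 := inv_mul_cancel₀ (by linarith)
  have hinv1 : (√(1 + x ^ 2))⁻¹ ≤ 1 := inv_le_one_of_one_le₀ hS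
  nlinarith [mul_le_mul_of_nonneg_left hle (sub_nonneg.2 hinv1)]

/-- A quadratic-type bound for the exponential moment of one step. The coefficient of the second
order term has the size `κ² v² + τ`, where `τ = l η² q²` accounts for the normalization; the
bound is linear in `v R` and otherwise only involves an exponential of `R`. -/
lemma exp_normalized_le {m v l η q R : ℝ} (h : m ^ 2 + v ^ 2 ≤ 1) (hl : 0 ≤ l)
    (hη : 0 ≤ η) (hq : 0 ≤ q) (hκ : l * η * q ≤ 1 / 4) :
    Real.exp (l * (1 - (√(1 + (η * q * R) ^ 2))⁻¹ * (m + (η * q * R) * v)))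
      ≤ Real.exp (l * (1 - m)) * (1 - l * η * q * v * R
        + 10 * ((l * η * q) ^ 2 * v ^ 2 + l * η ^ 2 * q ^ 2) * Real.exp (2 * |R|)) := by
  set κ := l * η * q with hκdef
  set x := η * q * R with hx
  set y := l * (√(1 + x ^ 2) - 1) with hy
  have hκ0 : 0 ≤ κ := by positivity
  have hv : |v| ≤ 1 := abs_le_one_iff_mul_self_le_one.2 (by nlinarith [sq_nonneg m])
  have hS1 : 1 ≤ √(1 + x ^ 2) := Real.one_le_sqrt.2 (by nlinarith [sq_nonneg x])
  have hS2 : √(1 + x ^ 2) ≤ 1 + x ^ 2 / 2 :=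
    Real.sqrt_le_iff.2 ⟨by positivity, by nlinarith [sq_nonneg (x ^ 2)]⟩
  have hS3 : √(1 + x ^ 2) ≤ 1 + |x| :=
    Real.sqrt_le_iff.2 ⟨by positivity, by nlinarith [abs_nonneg x, sq_abs x]⟩
  have hxabs : |x| = η * q * |R| := by
    rw [hx, abs_mul, abs_of_nonneg (by positivity)]
  have hy0 : 0 ≤ y := mul_nonneg hl (by linarith)
  set τ := l * η ^ 2 * q ^ 2 with hτ
  have hτ0 : 0 ≤ τ := by positivity
  have hy1 : y ≤ τ * R ^ 2 / 2 := by
    have := mul_le_mul_of_nonneg_left hS2 hl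
    have e : l * (x ^ 2 / 2) = τ * R ^ 2 / 2 := by rw [hx, hτ]; ring
    rw [hy]; linarith
  have hy2 : y ≤ κ * |R| := by
    have := mul_le_mul_of_nonneg_left hS3 hl
    have e : l * |x| = κ * |R| := by rw [hxabs, hκdef]; ring
    rw [hy]; linarith
  set z := -(κ * v * R) + y with hz
  have hR0 := abs_nonneg R
  have hz1 : |z| ≤ |R| / 2 := by
    have h1 : |κ * v * R| ≤ κ * |R| := by
      rw [abs_mul, abs_mul, abs_of_nonneg hκ0]
      have := mul_le_mul_of_nonneg_left hv (mul_nonneg hκ0 hR0)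
      linarith
    have h2 : |z| ≤ |κ * v * R| + y := by
      rw [hz]
      exact (abs_add_le _ _).trans_eq (by rw [abs_neg, abs_of_nonneg hy0])
    have h3 := mul_le_mul_of_nonneg_right hκ hR0
    linarith
  have hz2 : z ^ 2 ≤ 2 * κ ^ 2 * v ^ 2 * R ^ 2 + τ * |R| ^ 3 / 4 := by
    have h1 : y ^ 2 ≤ τ * R ^ 2 / 2 * (κ * |R|) := by
      rw [sq]; exact mul_le_mul hy1 hy2 hy0 (by positivity)
    have h2 : τ * R ^ 2 / 2 * (κ * |R|) ≤ τ * R ^ 2 / 2 * (1 / 4 * |R|) := by gcongr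
    have h3 : R ^ 2 * |R| = |R| ^ 3 := by rw [← sq_abs]; ring
    have h4 : z ^ 2 ≤ 2 * (κ * v * R) ^ 2 + 2 * y ^ 2 := by
      rw [hz]; nlinarith [sq_nonneg (κ * v * R + y)]
    nlinarith [h3]
  have hpoly2 : R ^ 2 ≤ 2 * Real.exp |R| := by
    have h2 := Real.pow_div_factorial_le_exp |R| hR0 2
    norm_num [Nat.factorial] at h2
    linarith
  have hpoly3 : |R| ^ 3 ≤ 6 * Real.exp |R| := by
    have h3 := Real.pow_div_factorial_le_exp |R| hR0 3
    norm_num [Nat.factorial] at h3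
    linarith
  have he1 : Real.exp |z| ≤ Real.exp |R| :=
    Real.exp_le_exp.2 (by linarith)
  have he0 : 1 ≤ Real.exp |R| := Real.one_le_exp hR0
  have hsum : Real.exp z ≤ 1 - κ * v * R + 10 * (κ ^ 2 * v ^ 2 + τ) * Real.exp (2 * |R|) := by
    have h1 := exp_le_one_add_add_sq_mul_exp_abs z
    have h2 : z ^ 2 * Real.exp |z|
        ≤ (2 * κ ^ 2 * v ^ 2 * R ^ 2 + τ * |R| ^ 3 / 4) * Real.exp |R| :=
      mul_le_mul hz2 he1 (Real.exp_pos _).le (by positivity)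
    have h3 : y ≤ τ * R ^ 2 / 2 * Real.exp |R| :=
      hy1.trans (le_mul_of_one_le_right (by positivity) he0)
    have h4 : 2 * κ ^ 2 * v ^ 2 * R ^ 2 + τ * |R| ^ 3 / 4 + τ * R ^ 2 / 2
        ≤ (κ ^ 2 * v ^ 2 + τ) * (10 * Real.exp |R|) := by
      have a1 : 2 * R ^ 2 ≤ 10 * Real.exp |R| := by
        linarith
      have a2 : |R| ^ 3 / 4 + R ^ 2 / 2 ≤ 10 * Real.exp |R| := by
        linarith
      linarith [mul_le_mul_of_nonneg_left a1 (by positivity : 0 ≤ κ ^ 2 * v ^ 2),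
        mul_le_mul_of_nonneg_left a2 hτ0]
    have h5 := mul_le_mul_of_nonneg_right h4 (Real.exp_pos |R|).le
    have h6 : Real.exp (2 * |R|) = Real.exp |R| * Real.exp |R| := by
      rw [← Real.exp_add]; ring_nf
    rw [h6]
    calc Real.exp z ≤ 1 + z + z ^ 2 * Real.exp |z| := h1
      _ ≤ 1 - κ * v * R + ((2 * κ ^ 2 * v ^ 2 * R ^ 2 + τ * |R| ^ 3 / 4 + τ * R ^ 2 / 2)
          * Real.exp |R|) := by
          have : z = -(κ * v * R) + y := hz
          linarith
      _ ≤ _ := by linarith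
  have hstep := mul_le_mul_of_nonneg_left (one_sub_normalized_le (x := x) h) hl
  calc Real.exp (l * (1 - (√(1 + x ^ 2))⁻¹ * (m + x * v)))
      ≤ Real.exp (l * (1 - m) + z) := by
        refine Real.exp_le_exp.2 (hstep.trans_eq ?_)
        rw [hz, hy, hκdef, hx]; ring
    _ = Real.exp (l * (1 - m)) * Real.exp z := Real.exp_add _ _
    _ ≤ _ := mul_le_mul_of_nonneg_left hsum (Real.exp_pos _).le

lemma exp_two_mul_abs_add_le {F ξ : ℝ} (hF : |F| ≤ 2) :
    Real.exp (2 * |F + ξ|) ≤ Real.exp 4 * (Real.exp (2 * ξ) + Real.exp (-2 * ξ)) := by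
  have h1 : 2 * |F + ξ| ≤ 4 + |2 * ξ| := by
    rw [abs_mul, abs_two]
    linarith [abs_add_le F ξ]
  refine (Real.exp_le_exp.2 h1).trans ?_
  rw [Real.exp_add]
  gcongr
  rcases abs_cases (2 * ξ) with h | h <;> rw [h.1]
  · linarith [Real.exp_pos (-2 * ξ)]
  · rw [neg_mul]; linarith [Real.exp_pos (2 * ξ)]

end OneStep

/-! ### Link functions near the maximal correlation -/

section Link

variable {γ₀ γ₁ γ₂ : ℝ} {f : ℝ → ℝ}

/-- The bounds on the derivative in integrated form. At interior points the derivative relative to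
`[-1, 1]` is the derivative, so the mean value inequality applies. -/
lemma IsLink.sub_bounds (hf : IsLink γ₀ γ₁ γ₂ f) (h0 : γ₀ ≤ 1 / 10)
    {x y : ℝ} (hx : 1 - γ₀ ≤ x) (hxy : x ≤ y) (hy : y ≤ 1) :
    γ₁ * (y - x) ≤ f y - f x ∧ f y - f x ≤ γ₂ * (y - x) := by
  have hsub : Icc (1 - γ₀) 1 ⊆ Icc (-1 : ℝ) 1 := Icc_subset_Icc_left (by linarith)
  have hcont : ContinuousOn f (Icc (1 - γ₀) 1) := fun z hz =>
    ((hf.differentiable z hz).mono hsub).continuousWithinAt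
  have hnhds : ∀ z ∈ interior (Icc (1 - γ₀) 1), Icc (-1 : ℝ) 1 ∈ nhds z := fun z hz =>
    Filter.mem_of_superset (mem_interior_iff_mem_nhds.1 hz) hsub
  have hdiff : DifferentiableOn ℝ f (interior (Icc (1 - γ₀) 1)) := fun z hz =>
    (hf.differentiable z (interior_subset hz)).mono (interior_subset.trans hsub)
  constructor
  · refine (convex_Icc _ _).mul_sub_le_image_sub_of_le_deriv hcont hdiff (fun z hz => ?_)
      x ⟨hx, hxy.trans hy⟩ y ⟨hx.trans hxy, hy⟩ hxy
    rw [← derivWithin_of_mem_nhds (hnhds z hz)]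
    exact hf.le_deriv z (interior_subset hz)
  · refine (convex_Icc _ _).image_sub_le_mul_sub_of_deriv_le hcont hdiff (fun z hz => ?_)
      x ⟨hx, hxy.trans hy⟩ y ⟨hx.trans hxy, hy⟩ hxy
    rw [← derivWithin_of_mem_nhds (hnhds z hz)]
    exact hf.deriv_le z (interior_subset hz)

lemma IsLink.mul_sub_ge (hf : IsLink γ₀ γ₁ γ₂ f) (h0 : γ₀ ≤ 1 / 10)
    {x h v : ℝ} (hh : 0 ≤ h) (hx : 1 - γ₀ ≤ x) (hx1 : x ≤ 1) (hy : 1 - γ₀ ≤ x + h * v)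
    (hy1 : x + h * v ≤ 1) :
    γ₁ * h * v ^ 2 ≤ v * (f (x + h * v) - f x) := by
  rcases le_total 0 v with hv | hv
  · have := (hf.sub_bounds h0 hx (le_add_of_nonneg_right (mul_nonneg hh hv)) hy1).1
    nlinarith [mul_le_mul_of_nonneg_left this hv]
  · have := (hf.sub_bounds h0 hy
      (add_le_of_nonpos_right (mul_nonpos_of_nonneg_of_nonpos hh hv)) hx1).1
    nlinarith [mul_le_mul_of_nonneg_left this (neg_nonneg.2 hv)]

end Link

/-! ### The spherical SGD update -/

section Update

variable {d : ℕ} {θs θ z : EuclideanSpace ℝ (Fin d)}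

lemma inner_sgdAction_self (hθ : ‖θ‖ = 1) (horth : inner ℝ θ z = 0) (σ : ℝ) :
    inner ℝ θ (sgdAction σ θ z) = √(1 - σ ^ 2) := by
  simp [sgdAction, inner_add_right, inner_smul_right, horth, hθ]

lemma sgdHalfStep_sgdAction (hθ : ‖θ‖ = 1) (horth : inner ℝ θ z = 0) (f : ℝ → ℝ) (η σ r : ℝ) :
    sgdHalfStep f η θ (sgdAction σ θ z) r
      = θ + (η * (derivWithin f (Icc (-1) 1) √(1 - σ ^ 2) * σ) * (r - f √(1 - σ ^ 2))) • z := by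
  rw [sgdHalfStep, inner_sgdAction_self hθ horth, sgdAction, add_sub_cancel_left, smul_smul,
    sub_eq_add_neg, ← neg_smul]
  congr 2
  ring

lemma norm_add_smul_of_orthonormal (hθ : ‖θ‖ = 1) (hz : ‖z‖ = 1) (horth : inner ℝ θ z = 0)
    (x : ℝ) : ‖θ + x • z‖ = √(1 + x ^ 2) := by
  have h : ‖θ + x • z‖ ^ 2 = 1 + x ^ 2 := by
    rw [norm_add_sq_real, inner_smul_right, horth, norm_smul, hθ, hz, Real.norm_eq_abs, mul_one,
      sq_abs]
    ring
  rw [← h, Real.sqrt_sq (norm_nonneg _)]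

lemma inner_sq_add_inner_sq_le (hθs : ‖θs‖ = 1) (hθ : ‖θ‖ = 1) (hz : ‖z‖ = 1)
    (horth : inner ℝ θ z = 0) : inner ℝ θs θ ^ 2 + inner ℝ θs z ^ 2 ≤ 1 := by
  have h := sq_nonneg ‖θs - (inner ℝ θs θ • θ + inner ℝ θs z • z)‖
  rw [norm_sub_sq_real, norm_add_sq_real, inner_add_right, inner_smul_left, inner_smul_right,
    inner_smul_right, inner_smul_right, horth, norm_smul, norm_smul, hθs, hθ, hz,
    Real.norm_eq_abs, Real.norm_eq_abs, mul_one, mul_one, sq_abs, sq_abs] at h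
  linarith

lemma norm_sgdStep (hθ : ‖θ‖ = 1) (hz : ‖z‖ = 1) (horth : inner ℝ θ z = 0) (f : ℝ → ℝ)
    (η σ r : ℝ) : ‖sgdStep f η θ (sgdAction σ θ z) r‖ = 1 := by
  rw [sgdStep, sgdHalfStep_sgdAction hθ horth, norm_smul, norm_inv, norm_norm,
    norm_add_smul_of_orthonormal hθ hz horth]
  exact inv_mul_cancel₀ (Real.sqrt_pos.2 (by positivity)).ne'

lemma one_sub_le_sqrt_one_sub_sq {σ : ℝ} (h0 : 0 ≤ σ) (h1 : σ ≤ 1) : 1 - σ ≤ √(1 - σ ^ 2) :=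
  Real.le_sqrt_of_sq_le (by nlinarith)

/-- Effect of one update on the exponential of the loss `1 - ⟪θs, θ⟫`. The quantities
`κ v ξ` and `κ v (f (c m) - f c)` are conditionally centred, `κ γ₁ σ v²` is the gain, and the last
summand collects the second order terms. -/
lemma exp_sgdStep_le {γ₀ γ₁ γ₂ : ℝ} {f : ℝ → ℝ} (hf : IsLink γ₀ γ₁ γ₂ f) (h0' : γ₀ ≤ 1 / 10)
    (hγ₁ : 0 < γ₁) (hθs : ‖θs‖ = 1) (hθ : ‖θ‖ = 1) (hz : ‖z‖ = 1) (horth : inner ℝ θ z = 0)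
    {σ η l ξ q : ℝ} (hσ0 : 0 ≤ σ) (hσ : σ ≤ γ₀ / 4) (hη : 0 ≤ η) (hl : 0 ≤ l)
    (hm : 1 - γ₀ / 2 ≤ inner ℝ θs θ)
    (hq : q = derivWithin f (Icc (-1) 1) √(1 - σ ^ 2) * σ) (hκ : l * η * q ≤ 1 / 4) :
    Real.exp (l * (1 - inner ℝ θs (sgdStep f η θ (sgdAction σ θ z)
        (f (inner ℝ θs (sgdAction σ θ z)) + ξ))))
      ≤ Real.exp (l * (1 - inner ℝ θs θ)) * (1 - l * η * q * (inner ℝ θs z * ξ)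
        - l * η * q * (inner ℝ θs z * (f (√(1 - σ ^ 2) * inner ℝ θs θ) - f √(1 - σ ^ 2)))
        - l * η * q * γ₁ * σ * inner ℝ θs z ^ 2
        + 10 * Real.exp 4 * ((l * η * q) ^ 2 * inner ℝ θs z ^ 2 + l * η ^ 2 * q ^ 2)
          * (Real.exp (2 * ξ) + Real.exp (-2 * ξ))) := by
  have hmv := inner_sq_add_inner_sq_le hθs hθ hz horth
  set m : ℝ := inner ℝ θs θ
  set v : ℝ := inner ℝ θs z
  set c := √(1 - σ ^ 2) with hc
  have hc1 : c ≤ 1 := Real.sqrt_le_one.2 (by nlinarith)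
  have hcσ : 1 - σ ≤ c := one_sub_le_sqrt_one_sub_sq hσ0 (by linarith)
  have hc2 : c ^ 2 = 1 - σ ^ 2 := Real.sq_sqrt (by nlinarith)
  have hm1 : m ≤ 1 := by nlinarith [sq_nonneg v]
  have hv := abs_le.1 (abs_le_one_iff_mul_self_le_one.2 (by nlinarith [sq_nonneg m]) : |v| ≤ 1)
  have hcm : 1 - γ₀ / 2 - σ ≤ c * m := by nlinarith
  have hcm1 : c * m ≤ 1 := by nlinarith
  have hy0 : 1 - γ₀ ≤ c * m + σ * v := by nlinarith
  have hy1 : c * m + σ * v ≤ 1 := by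
    nlinarith [sq_nonneg (c * v - σ * m), sq_nonneg (c - m), sq_nonneg (σ - v)]
  have hq0 : 0 ≤ q := by
    rw [hq]
    have := hf.le_deriv c ⟨by linarith, hc1⟩
    exact mul_nonneg (by linarith) hσ0
  have haction : inner ℝ θs (sgdAction σ θ z) = c * m + σ * v := by
    simp [sgdAction, inner_add_right, inner_smul_right, m, v, hc]
  set F := f (c * m + σ * v) - f c with hF
  have hF2 : |F| ≤ 2 := by
    have h1 := hf.bounded (x := c * m + σ * v) ⟨by linarith, hy1⟩
    have h2 := hf.bounded (x := c) ⟨by linarith, hc1⟩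
    rw [abs_le]
    constructor <;> linarith [h1.1, h1.2, h2.1, h2.2]
  have hstep : inner ℝ θs (sgdStep f η θ (sgdAction σ θ z) (f (inner ℝ θs (sgdAction σ θ z)) + ξ))
      = (√(1 + (η * q * (F + ξ)) ^ 2))⁻¹ * (m + η * q * (F + ξ) * v) := by
    rw [haction, sgdStep, sgdHalfStep_sgdAction hθ horth, ← hq,
      norm_add_smul_of_orthonormal hθ hz horth, inner_smul_right, inner_add_right,
      inner_smul_right]
    have : f (c * m + σ * v) + ξ - f c = F + ξ := by rw [hF]; ring
    rw [this]
  rw [hstep]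
  refine (exp_normalized_le hmv hl hη hq0 hκ).trans ?_
  refine mul_le_mul_of_nonneg_left ?_ (Real.exp_pos _).le
  have hgain : γ₁ * σ * v ^ 2 ≤ v * (f (c * m + σ * v) - f (c * m)) :=
    hf.mul_sub_ge h0' hσ0 (by linarith) hcm1 hy0 hy1
  have hκ0 : 0 ≤ l * η * q := by positivity
  have hgain' := mul_le_mul_of_nonneg_left hgain hκ0
  have hexp := mul_le_mul_of_nonneg_left (exp_two_mul_abs_add_le (ξ := ξ) hF2)
    (by positivity : 0 ≤ 10 * ((l * η * q) ^ 2 * v ^ 2 + l * η ^ 2 * q ^ 2))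
  have e1 : l * η * q * v * (F + ξ) = l * η * q * (v * ξ) + l * η * q * (v * (f (c * m) - f c))
      + l * η * q * (v * (f (c * m + σ * v) - f (c * m))) := by rw [hF]; ring
  rw [e1]
  linarith

end Update

/-! ### Contraction of the exponential moment in one round -/

section Round

variable {d : ℕ} {Ω : Type*} {m H : MeasurableSpace Ω} [mΩ : MeasurableSpace Ω] {μ : Measure Ω}
  [IsProbabilityMeasure μ] {θs : EuclideanSpace ℝ (Fin d)}
  {θ θ' Z : Ω → EuclideanSpace ℝ (Fin d)} {ξ : Ω → ℝ}

lemma abs_le_exp_add_exp_neg (x : ℝ) : |x| ≤ Real.exp x + Real.exp (-x) := by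
  rcases abs_cases x with h | h <;> rw [h.1]
  · linarith [Real.add_one_le_exp x, Real.exp_pos (-x)]
  · linarith [Real.add_one_le_exp (-x), Real.exp_pos x]

/-- One round, with an arbitrary `m`-measurable weight `W ≥ 0`: the weighted exponential bound
of `exp_sgdStep_le` integrates to a contraction in the second moment of the exploration. -/
lemma integral_weight_le {W D v G : Ω → ℝ} (hm : m ≤ mΩ) (hH : H ≤ mΩ)
    (hmH : m ≤ H) {K κ τ g C : ℝ} (hW : Measurable[m] W) (hWK : ∀ ω, |W ω| ≤ K)
    (hW0 : ∀ ω, 0 ≤ W ω) (hD : Measurable[m] D) (hDK : ∀ ω, |D ω| ≤ 2) (hv : Measurable[H] v)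
    (hv1 : ∀ᵐ ω ∂μ, |v ω| ≤ 1) (hξ : Integrable ξ μ) (hξ0 : μ[ξ | H] =ᵐ[μ] 0)
    (hG : Integrable G μ) (hGC : μ[G | H] ≤ᵐ[μ] fun _ => C) (hvm : μ[v | m] =ᵐ[μ] 0)
    {V : Ω → ℝ} (hvV : μ[fun ω => v ω ^ 2 | m] =ᵐ[μ] V) (hτ : 0 ≤ τ) {B : ℝ} (hB : 0 ≤ B)
    (hκg : B * C * κ ^ 2 ≤ g / 2) :
    Integrable (fun ω => W ω * (1 - κ * (v ω * ξ ω) - κ * (v ω * D ω) - g * v ω ^ 2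
      + B * (κ ^ 2 * v ω ^ 2 + τ) * G ω)) μ ∧
    ∫ ω, W ω * (1 - κ * (v ω * ξ ω) - κ * (v ω * D ω) - g * v ω ^ 2
      + B * (κ ^ 2 * v ω ^ 2 + τ) * G ω) ∂μ
      ≤ ∫ ω, W ω * (1 + B * C * τ - g / 2 * V ω) ∂μ := by
  have hK0 : 0 ≤ K := (abs_nonneg _).trans (hWK (Classical.choice μ.nonempty_of_neZero))
  have hWH : Measurable[H] W := hW.mono hmH le_rfl
  have hWΩ : Measurable W := hW.mono hm le_rfl
  have hDΩ : Measurable D := hD.mono hm le_rfl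
  have hvΩ : Measurable v := hv.mono hH le_rfl
  have hv2 : ∀ᵐ ω ∂μ, v ω ^ 2 ≤ 1 := hv1.mono fun ω h => by
    rw [← sq_abs]; exact pow_le_one₀ (abs_nonneg _) h
  have iv : Integrable v μ := Integrable.of_bound hvΩ.aestronglyMeasurable 1 hv1
  have iv2 : Integrable (fun ω => v ω ^ 2) μ :=
    Integrable.of_bound (hvΩ.pow_const 2).aestronglyMeasurable 1
      (hv2.mono fun ω h => by rwa [Real.norm_eq_abs, abs_of_nonneg (sq_nonneg _)])
  have bWv : ∀ᵐ ω ∂μ, |W ω * v ω| ≤ K := hv1.mono fun ω h => by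
    rw [abs_mul]; exact (mul_le_of_le_one_right (abs_nonneg _) h).trans (hWK ω)
  have bWD (ω : Ω) : |W ω * D ω| ≤ K * 2 := by
    rw [abs_mul]; exact mul_le_mul (hWK ω) (hDK ω) (abs_nonneg _) hK0
  have bWq : ∀ᵐ ω ∂μ, |W ω * (κ ^ 2 * v ω ^ 2 + τ)| ≤ K * (κ ^ 2 + τ) := hv2.mono fun ω h => by
    rw [abs_mul, abs_of_nonneg (by positivity : 0 ≤ κ ^ 2 * v ω ^ 2 + τ)]
    refine mul_le_mul (hWK ω) ?_ (by positivity) hK0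
    have := mul_le_mul_of_nonneg_left h (sq_nonneg κ)
    linarith
  have iW : Integrable W μ :=
    Integrable.of_bound hWΩ.aestronglyMeasurable K (.of_forall hWK)
  have iξ : Integrable (fun ω => (W ω * v ω) * ξ ω) μ :=
    hξ.bdd_mul (hWΩ.mul hvΩ).aestronglyMeasurable bWv
  have iD : Integrable (fun ω => (W ω * D ω) * v ω) μ :=
    iv.bdd_mul (hWΩ.mul hDΩ).aestronglyMeasurable (.of_forall bWD)
  have i2 : Integrable (fun ω => W ω * v ω ^ 2) μ :=
    iv2.bdd_mul hWΩ.aestronglyMeasurable (.of_forall hWK)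
  have hqH : Measurable[H] fun ω => W ω * (κ ^ 2 * v ω ^ 2 + τ) :=
    hWH.mul (((hv.pow_const 2).const_mul _).add_const _)
  have iG : Integrable (fun ω => (W ω * (κ ^ 2 * v ω ^ 2 + τ)) * G ω) μ :=
    hG.bdd_mul (hqH.mono hH le_rfl).aestronglyMeasurable bWq
  have eξ : ∫ ω, (W ω * v ω) * ξ ω ∂μ = 0 := by
    rw [integral_mul_condExp (X := fun ω => W ω * v ω) hH (hWH.mul hv) bWv hξ]
    refine (integral_congr_ae ?_).trans (integral_zero Ω ℝ)
    filter_upwards [hξ0] with ω h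
    simp [h]
  have eD : ∫ ω, (W ω * D ω) * v ω ∂μ = 0 := by
    rw [integral_mul_condExp (X := fun ω => W ω * D ω) hm (hW.mul hD) (.of_forall bWD) iv]
    refine (integral_congr_ae ?_).trans (integral_zero Ω ℝ)
    filter_upwards [hvm] with ω h
    simp [h]
  have e2 : ∫ ω, W ω * v ω ^ 2 ∂μ = ∫ ω, W ω * V ω ∂μ := by
    rw [integral_mul_condExp hm hW (.of_forall hWK) iv2]
    refine integral_congr_ae ?_
    filter_upwards [hvV] with ω h
    rw [h]
  have iV : Integrable (fun ω => W ω * V ω) μ := by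
    have : Integrable (fun ω => W ω * (μ[fun ω => v ω ^ 2 | m]) ω) μ :=
      integrable_condExp.bdd_mul hWΩ.aestronglyMeasurable (.of_forall hWK)
    refine this.congr ?_
    filter_upwards [hvV] with ω h
    rw [h]
  have eG : ∫ ω, (W ω * (κ ^ 2 * v ω ^ 2 + τ)) * G ω ∂μ
      ≤ C * (κ ^ 2 * ∫ ω, W ω * v ω ^ 2 ∂μ + τ * ∫ ω, W ω ∂μ) := by
    rw [integral_mul_condExp hH hqH bWq hG, ← integral_const_mul, ← integral_const_mul,
      ← integral_add (i2.const_mul _) (iW.const_mul _), ← integral_const_mul]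
    refine integral_mono_ae
      (integrable_condExp.bdd_mul (hqH.mono hH le_rfl).aestronglyMeasurable bWq)
      (((i2.const_mul _).add (iW.const_mul _)).const_mul _) ?_
    filter_upwards [hGC] with ω h
    have := mul_le_mul_of_nonneg_left h
      (mul_nonneg (hW0 ω) (by positivity : 0 ≤ κ ^ 2 * v ω ^ 2 + τ))
    linarith
  have esplit : (fun ω => W ω * (1 - κ * (v ω * ξ ω) - κ * (v ω * D ω) - g * v ω ^ 2
      + B * (κ ^ 2 * v ω ^ 2 + τ) * G ω)) = fun ω => W ω - κ * ((W ω * v ω) * ξ ω)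
      - κ * ((W ω * D ω) * v ω) - g * (W ω * v ω ^ 2)
      + B * ((W ω * (κ ^ 2 * v ω ^ 2 + τ)) * G ω) := by
    funext ω; ring
  have j1 : Integrable (fun ω => W ω - κ * ((W ω * v ω) * ξ ω)) μ := iW.sub (iξ.const_mul κ)
  have j2 : Integrable (fun ω => W ω - κ * ((W ω * v ω) * ξ ω)
      - κ * ((W ω * D ω) * v ω)) μ := j1.sub (iD.const_mul κ)
  have j3 : Integrable (fun ω => W ω - κ * ((W ω * v ω) * ξ ω)
      - κ * ((W ω * D ω) * v ω) - g * (W ω * v ω ^ 2)) μ := j2.sub (i2.const_mul g)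
  rw [esplit]
  refine ⟨j3.add (iG.const_mul B), ?_⟩
  have esplit' : (fun ω => W ω * (1 + B * C * τ - g / 2 * V ω))
      = fun ω => (1 + B * C * τ) * W ω - g / 2 * (W ω * V ω) := by funext ω; ring
  rw [esplit', integral_sub (iW.const_mul _) (iV.const_mul _), integral_const_mul,
    integral_const_mul, ← e2]
  have elhs : ∫ ω, W ω - κ * ((W ω * v ω) * ξ ω) - κ * ((W ω * D ω) * v ω) - g * (W ω * v ω ^ 2)
      + B * ((W ω * (κ ^ 2 * v ω ^ 2 + τ)) * G ω) ∂μ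
      = ∫ ω, W ω ∂μ - κ * 0 - κ * 0 - g * ∫ ω, W ω * v ω ^ 2 ∂μ
      + B * ∫ ω, (W ω * (κ ^ 2 * v ω ^ 2 + τ)) * G ω ∂μ := by
    rw [integral_add j3 (iG.const_mul B), integral_sub j2 (i2.const_mul g),
      integral_sub j1 (iD.const_mul κ), integral_sub iW (iξ.const_mul κ), integral_const_mul,
      integral_const_mul, integral_const_mul, integral_const_mul, eξ, eD]
  rw [elhs]
  have h2 : 0 ≤ ∫ ω, W ω * v ω ^ 2 ∂μ :=
    integral_nonneg fun ω => mul_nonneg (hW0 ω) (sq_nonneg _)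
  have h3 := mul_le_mul_of_nonneg_left eG hB
  have h4 := mul_le_mul_of_nonneg_right hκg h2
  linarith

end Round

section Round

variable {d : ℕ} {Ω : Type*} {m H : MeasurableSpace Ω} [mΩ : MeasurableSpace Ω] {μ : Measure Ω}
  [IsProbabilityMeasure μ] {θs : EuclideanSpace ℝ (Fin d)}
  {θ θ' Z : Ω → EuclideanSpace ℝ (Fin d)} {ξ : Ω → ℝ}

/-- Only the restriction of `f` to `[-1, 1]` is monotone, and `f` itself need not be measurable. -/
lemma IsLink.measurable_clamp {γ₀ γ₁ γ₂ : ℝ} {f : ℝ → ℝ} (hf : IsLink γ₀ γ₁ γ₂ f) :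
    Measurable fun x => f (max (-1) (min 1 x)) := by
  refine Monotone.measurable fun x y hxy => hf.monotone ?_ ?_ (by gcongr)
  all_goals exact ⟨le_max_left _ _, max_le (by norm_num) (min_le_left _ _)⟩

/-- The gain of a round, expressed as a decrease of the exponent. -/
lemma exp_gain_le {γ₁ γ₂ d σ η l l₀ q M C : ℝ} (hγ₁ : 0 < γ₁) (hd' : 2 ≤ d)
    (hσ0 : 0 ≤ σ) (hη : 0 ≤ η) (hl : 0 ≤ l) (hC : 0 ≤ C) (hq1 : γ₁ * σ ≤ q) (hq2 : q ≤ γ₂ * σ)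
    (hl₀ : l * (1 - γ₁ ^ 2 * η * σ ^ 2 / (2 * d)) ≤ l₀) (hm1 : M ≤ 1) (hM : 0 ≤ M) :
    Real.exp (l * (1 - M)) * (1 + C * (l * η ^ 2 * q ^ 2)
      - l * η * q * γ₁ * σ / 2 * ((1 ^ 2 - M ^ 2) / (d - 1)))
      ≤ Real.exp (C * γ₂ ^ 2 * (l * η ^ 2 * σ ^ 2)) * Real.exp (l₀ * (1 - M)) := by
  have hq0 : 0 ≤ q := (by positivity : 0 ≤ γ₁ * σ).trans hq1
  have hgain : (1 - M) / d ≤ (1 ^ 2 - M ^ 2) / (d - 1) := by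
    rw [div_le_div_iff₀ (by linarith) (by linarith)]
    nlinarith [mul_nonneg (sub_nonneg.2 hm1) hM]
  have hκγ : l * η * γ₁ ^ 2 * σ ^ 2 ≤ l * η * q * γ₁ * σ := by
    have := mul_le_mul_of_nonneg_left hq1 (by positivity : 0 ≤ l * η * (γ₁ * σ))
    linarith
  have hdrift : l * η * γ₁ ^ 2 * σ ^ 2 / 2 * ((1 - M) / d)
      ≤ l * η * q * γ₁ * σ / 2 * ((1 ^ 2 - M ^ 2) / (d - 1)) :=
    mul_le_mul (by linarith) hgain (div_nonneg (by linarith) (by linarith)) (by positivity)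
  have hτ : l * η ^ 2 * q ^ 2 ≤ γ₂ ^ 2 * (l * η ^ 2 * σ ^ 2) := by
    have := mul_le_mul_of_nonneg_left (pow_le_pow_left₀ hq0 hq2 2)
      (by positivity : 0 ≤ l * η ^ 2)
    linarith
  have hτ' := mul_le_mul_of_nonneg_left hτ hC
  have hl₀' := mul_le_mul_of_nonneg_right hl₀ (sub_nonneg.2 hm1)
  have e1 : l * (1 - γ₁ ^ 2 * η * σ ^ 2 / (2 * d)) * (1 - M)
      = l * (1 - M) - l * η * γ₁ ^ 2 * σ ^ 2 / 2 * ((1 - M) / d) := by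
    field_simp
  rw [← Real.exp_add]
  set a := C * (l * η ^ 2 * q ^ 2)
    - l * η * q * γ₁ * σ / 2 * ((1 ^ 2 - M ^ 2) / (d - 1)) with ha
  calc Real.exp (l * (1 - M)) * _ ≤ Real.exp (l * (1 - M)) * Real.exp a := by
        refine mul_le_mul_of_nonneg_left ?_ (Real.exp_pos _).le
        linarith [Real.add_one_le_exp a]
    _ = Real.exp (l * (1 - M) + a) := (Real.exp_add _ _).symm
    _ ≤ _ := Real.exp_le_exp.2 (by linarith)

/-- Contraction of the exponential moment of the loss in one round, on a past event `A` on which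
the current parameter is close to `θs`. -/
lemma round_exp_moment_le {γ₀ γ₁ γ₂ : ℝ} {f : ℝ → ℝ} (hf : IsLink γ₀ γ₁ γ₂ f)
    (h0' : γ₀ ≤ 1 / 10) (hγ₁ : 0 < γ₁) (hγ₂ : 0 < γ₂) (hd : 2 ≤ d) (hθs : ‖θs‖ = 1)
    (hH : H ≤ mΩ) (hmH : m ≤ H) (hZH : Measurable[H] Z)
    (hθm : Measurable[m] θ) (hθ1 : ∀ᵐ ω ∂μ, ‖θ ω‖ = 1)
    (hθ' : Measurable θ') (hξ : Measurable ξ) (h : IsUniformOrth μ m θ Z)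
    (hξ0 : μ[ξ | H] =ᵐ[μ] 0)
    (hint : ∀ l : ℝ, Integrable (fun ω => Real.exp (l * ξ ω)) μ)
    (hsub : ∀ l : ℝ, μ[fun ω => Real.exp (l * ξ ω) | H]
      ≤ᵐ[μ] fun _ => Real.exp (l ^ 2 / 2))
    {σ η l l₀ : ℝ} (hσ0 : 0 ≤ σ) (hσ : σ ≤ γ₀ / 4) (hη : 0 ≤ η) (hl : 0 ≤ l)
    (hupd : ∀ ω, θ' ω = sgdStep f η (θ ω) (sgdAction σ (θ ω) (Z ω))
      (f (inner ℝ θs (sgdAction σ (θ ω) (Z ω))) + ξ ω))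
    (hlη : l * η * γ₂ ≤ 1 / 4) (hlη' : 20 * Real.exp 6 * (l * η * γ₂) ≤ γ₁ / 2)
    (hl₀ : l * (1 - γ₁ ^ 2 * η * σ ^ 2 / (2 * d)) ≤ l₀)
    {A : Set Ω} (hA : MeasurableSet[m] A) (hAθ : ∀ ω ∈ A, 1 - γ₀ / 2 ≤ inner ℝ θs (θ ω)) :
    IntegrableOn (fun ω => Real.exp (l * (1 - inner ℝ θs (θ' ω)))) A μ ∧
    ∫ ω in A, Real.exp (l * (1 - inner ℝ θs (θ' ω))) ∂μ
      ≤ Real.exp (20 * Real.exp 6 * γ₂ ^ 2 * (l * η ^ 2 * σ ^ 2))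
        * ∫ ω in A, Real.exp (l₀ * (1 - inner ℝ θs (θ ω))) ∂μ := by
  have hm : m ≤ mΩ := hmH.trans hH
  have hZ : Measurable Z := hZH.mono hH le_rfl
  have hAΩ : MeasurableSet A := hm _ hA
  have hd' : (2 : ℝ) ≤ d := by exact_mod_cast hd
  have hσ1 : σ ≤ 1 := by linarith
  set c := √(1 - σ ^ 2) with hc
  have hc0 : 0 ≤ c := Real.sqrt_nonneg _
  have hc1 : c ≤ 1 := Real.sqrt_le_one.2 (by nlinarith)
  have hcσ : 1 - γ₀ ≤ c := by linarith [one_sub_le_sqrt_one_sub_sq hσ0 hσ1]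
  set q := derivWithin f (Icc (-1) 1) c * σ with hq
  have hq1 : γ₁ * σ ≤ q := by
    rw [hq]; gcongr; exact hf.le_deriv c ⟨hcσ, hc1⟩
  have hq2 : q ≤ γ₂ * σ := by
    rw [hq]; gcongr; exact hf.deriv_le c ⟨hcσ, hc1⟩
  have hq0 : 0 ≤ q := (by positivity : 0 ≤ γ₁ * σ).trans hq1
  have hlη0 : 0 ≤ l * η := mul_nonneg hl hη
  have hκ1 : l * η * q ≤ l * η * γ₂ * σ := by
    have := mul_le_mul_of_nonneg_left hq2 hlη0
    linarith
  have hκ2 : l * η * γ₂ * σ ≤ l * η * γ₂ := mul_le_of_le_one_right (by positivity) hσ1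
  have hκ0 : 0 ≤ l * η * q := by positivity
  -- the weight, the drift caused by the mismatch of the baselines, and the correlation
  set W : Ω → ℝ := A.indicator fun ω => Real.exp (l * (1 - inner ℝ θs (θ ω))) with hW
  set D : Ω → ℝ := fun ω => f (max (-1) (min 1 (c * inner ℝ θs (θ ω)))) - f c with hD
  set v : Ω → ℝ := fun ω => inner ℝ θs (Z ω) with hv
  have hinner : Measurable fun x : EuclideanSpace ℝ (Fin d) => inner ℝ θs x := by fun_prop
  have hip : Measurable[m] fun ω => inner ℝ θs (θ ω) := hinner.comp hθm
  have hWm : Measurable[m] W :=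
    (Real.measurable_exp.comp ((hip.const_sub 1).const_mul l)).indicator hA
  have hW0 (ω : Ω) : 0 ≤ W ω := indicator_nonneg (fun _ _ => (Real.exp_pos _).le) ω
  have hWK (ω : Ω) : |W ω| ≤ Real.exp l := by
    rw [abs_of_nonneg (hW0 ω), hW]
    by_cases hω : ω ∈ A
    · rw [indicator_of_mem hω]
      refine Real.exp_le_exp.2 (mul_le_of_le_one_right hl ?_)
      linarith [hAθ ω hω]
    · rw [indicator_of_notMem hω]; exact (Real.exp_pos _).le
  have hDm : Measurable[m] D := (hf.measurable_clamp.comp (hip.const_mul c)).sub_const _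
  have hDK (ω : Ω) : |D ω| ≤ 2 := by
    have h1 := hf.bounded (x := max (-1) (min 1 (c * inner ℝ θs (θ ω))))
      ⟨le_max_left _ _, max_le (by norm_num) (min_le_left _ _)⟩
    have h2 := hf.bounded (x := c) ⟨by linarith, hc1⟩
    rw [abs_le]
    constructor <;> simp only [hD] <;> linarith [h1.1, h1.2, h2.1, h2.2]
  have hZ1 := h.ae_norm_inner hθm
  have hv1 : ∀ᵐ ω ∂μ, |v ω| ≤ 1 := hZ1.mono fun ω hω => by
    simpa [hθs, hω.1] using abs_real_inner_le_norm θs (Z ω)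
  have hintξ : Integrable ξ μ := by
    refine ((hint 1).add (hint (-1))).mono' hξ.aestronglyMeasurable (.of_forall fun ω => ?_)
    simpa using abs_le_exp_add_exp_neg (ξ ω)
  have hG : Integrable (fun ω => Real.exp (2 * ξ ω) + Real.exp (-2 * ξ ω)) μ :=
    (hint 2).add (hint (-2))
  have hGC : μ[fun ω => Real.exp (2 * ξ ω) + Real.exp (-2 * ξ ω) | H]
      ≤ᵐ[μ] fun _ => 2 * Real.exp 2 := by
    filter_upwards [condExp_add (m := H) (hint 2) (hint (-2)), hsub 2, hsub (-2)] with ω h1 h2 h3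
    rw [show (2 : ℝ) ^ 2 / 2 = 2 by norm_num] at h2
    rw [show (-2 : ℝ) ^ 2 / 2 = 2 by norm_num] at h3
    refine (le_of_eq h1).trans ?_
    simp only [Pi.add_apply]
    linarith
  have hC : 10 * Real.exp 4 * (2 * Real.exp 2) = 20 * Real.exp 6 := by
    have : Real.exp 6 = Real.exp 4 * Real.exp 2 := by rw [← Real.exp_add]; norm_num
    rw [this]; ring
  obtain ⟨hI, hle⟩ := integral_weight_le (μ := μ) (ξ := ξ) (κ := l * η * q) (τ := l * η ^ 2 * q ^ 2)
    (g := l * η * q * γ₁ * σ) (B := 10 * Real.exp 4) hm hH hmH hWm hWK hW0 hDm hDK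
    (hinner.comp hZH) hv1 hintξ hξ0 hG hGC (h.condExp_inner hm hd hθm hθ1 hZ θs)
    (h.condExp_inner_sq hm hd hθm hθ1 hZ θs) (by positivity) (by positivity) (by
      rw [hC]
      have h1 := mul_le_mul_of_nonneg_right hlη' (mul_nonneg hκ0 hσ0)
      have h2 := mul_le_mul_of_nonneg_left hκ1
        (by positivity : 0 ≤ 20 * Real.exp 6 * (l * η * q))
      nlinarith)
  rw [hC] at hle
  have hpt : ∀ᵐ ω ∂μ, A.indicator (fun ω => Real.exp (l * (1 - inner ℝ θs (θ' ω)))) ω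
      ≤ W ω * (1 - l * η * q * (v ω * ξ ω) - l * η * q * (v ω * D ω)
        - l * η * q * γ₁ * σ * v ω ^ 2 + 10 * Real.exp 4 * ((l * η * q) ^ 2 * v ω ^ 2
        + l * η ^ 2 * q ^ 2) * (Real.exp (2 * ξ ω) + Real.exp (-2 * ξ ω))) := by
    filter_upwards [hZ1, hθ1] with ω hω1 hω2
    by_cases hω : ω ∈ A
    · have hm1 : inner ℝ θs (θ ω) ≤ 1 := by
        simpa [hθs, hω2] using real_inner_le_norm θs (θ ω)
      have hcm : max (-1) (min 1 (c * inner ℝ θs (θ ω))) = c * inner ℝ θs (θ ω) := by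
        have := hAθ ω hω
        rw [min_eq_right (by nlinarith), max_eq_right (by nlinarith)]
      simp only [hW, hD, hv, indicator_of_mem hω, hcm]
      rw [hupd]
      exact exp_sgdStep_le hf h0' hγ₁ hθs hω2 hω1.1 hω1.2 hσ0 hσ hη hl (hAθ ω hω) hq
        (by linarith)
    · simp [hW, indicator_of_notMem hω]
  have hLint : Integrable (A.indicator fun ω => Real.exp (l * (1 - inner ℝ θs (θ' ω)))) μ := by
    refine hI.mono' ?_ ?_
    · exact ((Real.measurable_exp.comp (((hinner.comp hθ').const_sub 1).const_mul l)).indicator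
        hAΩ).aestronglyMeasurable
    · filter_upwards [hpt] with ω hω
      rwa [Real.norm_eq_abs, abs_of_nonneg (indicator_nonneg (fun _ _ => (Real.exp_pos _).le) ω)]
  have hfin : ∀ᵐ ω ∂μ, W ω * (1 + 20 * Real.exp 6 * (l * η ^ 2 * q ^ 2)
      - l * η * q * γ₁ * σ / 2 * ((‖θs‖ ^ 2 - inner ℝ θs (θ ω) ^ 2) / ((d : ℝ) - 1)))
      ≤ A.indicator (fun ω => Real.exp (20 * Real.exp 6 * γ₂ ^ 2 * (l * η ^ 2 * σ ^ 2))
        * Real.exp (l₀ * (1 - inner ℝ θs (θ ω)))) ω := by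
    filter_upwards [hθ1] with ω hω2
    by_cases hω : ω ∈ A
    · have hm1 : inner ℝ θs (θ ω) ≤ 1 := by
        simpa [hθs, hω2] using real_inner_le_norm θs (θ ω)
      have hm0 := hAθ ω hω
      simp only [hW, indicator_of_mem hω, hθs]
      set M : ℝ := inner ℝ θs (θ ω)
      exact exp_gain_le hγ₁ hd' hσ0 hη hl (by positivity) hq1 hq2 hl₀ hm1 (by linarith)
    · simp [hW, indicator_of_notMem hω]
  have hRint : Integrable (A.indicator fun ω =>
      Real.exp (20 * Real.exp 6 * γ₂ ^ 2 * (l * η ^ 2 * σ ^ 2))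
        * Real.exp (l₀ * (1 - inner ℝ θs (θ ω)))) μ := by
    refine Integrable.indicator (Integrable.const_mul ?_ _) hAΩ
    refine Integrable.of_bound (Real.measurable_exp.comp
      (((hip.mono hm le_rfl).const_sub 1).const_mul l₀)).aestronglyMeasurable
      (Real.exp (|l₀| * 2)) ?_
    filter_upwards [hθ1] with ω hω
    have := abs_real_inner_le_norm θs (θ ω)
    rw [hθs, hω, mul_one] at this
    rw [Real.norm_eq_abs, Real.abs_exp]
    refine Real.exp_le_exp.2 ((le_abs_self _).trans ?_)
    rw [abs_mul]
    gcongr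
    rw [abs_le] at this ⊢
    constructor <;> linarith
  refine ⟨(integrable_indicator_iff hAΩ).1 hLint, ?_⟩
  rw [← integral_const_mul, ← integral_indicator hAΩ, ← integral_indicator hAΩ]
  refine (integral_mono_ae hLint hI hpt).trans (hle.trans ?_)
  by_cases hWi : Integrable (fun ω => W ω * (1 + 20 * Real.exp 6 * (l * η ^ 2 * q ^ 2)
      - l * η * q * γ₁ * σ / 2 * ((‖θs‖ ^ 2 - inner ℝ θs (θ ω) ^ 2) / ((d : ℝ) - 1)))) μ
  · exact integral_mono_ae hWi hRint hfin
  · rw [integral_undef hWi]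
    exact integral_nonneg fun ω => indicator_nonneg (fun _ _ => by positivity) ω

end Round

/-! ### Confinement of the trajectory -/

section Trajectory

variable {d : ℕ} {Ω : Type*} [mΩ : MeasurableSpace Ω] {μ : Measure Ω}
  {𝓕 : Filtration ℕ mΩ} {f : ℝ → ℝ} {θs : EuclideanSpace ℝ (Fin d)} {η σ : ℕ → ℝ}
  {θ Z : ℕ → Ω → EuclideanSpace ℝ (Fin d)} {ξ : ℕ → Ω → ℝ}

lemma IsInteractiveSGD.isUniformOrth (h : IsInteractiveSGD μ 𝓕 f θs η σ θ Z ξ) {t : ℕ}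
    (ht : 1 ≤ t) : IsUniformOrth μ (𝓕 t) (θ t) (Z t) := h.law_dir t ht

lemma IsInteractiveSGD.ae_norm [IsProbabilityMeasure μ]
    (h : IsInteractiveSGD μ 𝓕 f θs η σ θ Z ξ) {t : ℕ} (ht : 1 ≤ t) :
    ∀ᵐ ω ∂μ, ‖θ t ω‖ = 1 := by
  induction t, ht using Nat.le_induction with
  | base => exact .of_forall h.norm_init
  | succ t ht ih =>
    filter_upwards [ih, (h.isUniformOrth ht).ae_norm_inner (h.measurable_param t ht)] with ω h1 h2
    rw [h.update t ht ω]
    exact norm_sgdStep h1 h2.1 h2.2 _ _ _ _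

/-- If the exponential weights `l t` are compatible with the learning rates and `b t` is large
enough compared with the accumulated second order terms `B t`, then each of the bounds
`1 - ⟪θs, θ t⟫ ≤ b t` is violated for the first time with probability at most `δ`. -/
theorem IsInteractiveSGD.confined [IsProbabilityMeasure μ] {γ₀ γ₁ γ₂ : ℝ}
    (h : IsInteractiveSGD μ 𝓕 f θs η σ θ Z ξ)
    (hf : IsLink γ₀ γ₁ γ₂ f) (h0' : γ₀ ≤ 1 / 10) (hγ₁ : 0 < γ₁)
    (hγ₂ : 0 < γ₂) (hd : 2 ≤ d) (hθs : ‖θs‖ = 1)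
    (hinit : ∀ᵐ ω ∂μ, 1 - γ₀ / 4 ≤ inner ℝ θs (θ 1 ω)) {δ : ℝ} (hδ : 0 < δ)
    {l B b : ℕ → ℝ} (hσ0 : ∀ t, 1 ≤ t → 0 ≤ σ t) (hσ : ∀ t, 1 ≤ t → σ t ≤ γ₀ / 4)
    (hη : ∀ t, 1 ≤ t → 0 ≤ η t) (hl : ∀ t, 1 ≤ t → 0 ≤ l t)
    (hlη : ∀ t, 1 ≤ t → l (t + 1) * η t * γ₂ ≤ 1 / 4)
    (hlη' : ∀ t, 1 ≤ t → 20 * Real.exp 6 * (l (t + 1) * η t * γ₂) ≤ γ₁ / 2)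
    (hll : ∀ t, 1 ≤ t → l (t + 1) * (1 - γ₁ ^ 2 * η t * σ t ^ 2 / (2 * d)) ≤ l t)
    (hB1 : l 1 * (γ₀ / 4) ≤ B 1)
    (hB : ∀ t, 1 ≤ t →
      B t + 20 * Real.exp 6 * γ₂ ^ 2 * (l (t + 1) * η t ^ 2 * σ t ^ 2) ≤ B (t + 1))
    (hb1 : γ₀ / 4 ≤ b 1) (hbγ : ∀ t, 1 ≤ t → b t ≤ γ₀ / 2)
    (hb : ∀ t, 1 ≤ t → B t + Real.log (1 / δ) ≤ l t * b t) {T : ℕ} (hT : 1 ≤ T) :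
    1 - δ * T ≤ μ.real {ω | ∀ t, 1 ≤ t → t ≤ T → 1 - inner ℝ θs (θ t ω) ≤ b t} := by
  set A : ℕ → Set Ω := fun T => {ω | ∀ t, 1 ≤ t → t ≤ T → 1 - inner ℝ θs (θ t ω) ≤ b t} with hA
  have hinner : Measurable fun x : EuclideanSpace ℝ (Fin d) => inner ℝ θs x := by fun_prop
  have hset (t : ℕ) (ht : 1 ≤ t) : MeasurableSet[𝓕 t] {ω | 1 - inner ℝ θs (θ t ω) ≤ b t} :=
    @measurableSet_le _ _ _ _ _ (𝓕 t) _ _ _ _ _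
      ((hinner.comp (h.measurable_param t ht)).const_sub 1) measurable_const
  have hAsucc (t : ℕ) (ht : 1 ≤ t) :
      A (t + 1) = A t ∩ {ω | 1 - inner ℝ θs (θ (t + 1) ω) ≤ b (t + 1)} := by
    ext ω
    constructor
    · exact fun hω => ⟨fun s h1 h2 => hω s h1 (h2.trans t.le_succ), hω _ (by omega) le_rfl⟩
    · rintro ⟨h1, h2⟩ s hs hs'
      rcases Nat.le_succ_iff.1 hs' with hs' | rfl
      · exact h1 s hs hs'
      · exact h2
  have hA1 : A 1 = {ω | 1 - inner ℝ θs (θ 1 ω) ≤ b 1} := by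
    ext ω
    refine ⟨fun hω => hω 1 le_rfl le_rfl, fun hω s h1 h2 => ?_⟩
    obtain rfl : s = 1 := by omega
    exact hω
  have hAmeas (t : ℕ) (ht : 1 ≤ t) : MeasurableSet[𝓕 t] (A t) := by
    induction t, ht using Nat.le_induction with
    | base => rw [hA1]; exact hset 1 le_rfl
    | succ t ht ih =>
      rw [hAsucc t ht]
      exact (𝓕.mono t.le_succ _ ih).inter (hset (t + 1) (by omega))
  have hround (t : ℕ) (ht : 1 ≤ t) := by
    have hZΩ : Measurable (Z t) := (h.measurable_dir t ht).mono (𝓕.le _) le_rfl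
    exact round_exp_moment_le (μ := μ) (m := 𝓕 t)
      (H := 𝓕 t ⊔ MeasurableSpace.comap (Z t) inferInstance) (l := l (t + 1)) (l₀ := l t)
      hf h0' hγ₁ hγ₂ hd hθs (sup_le (𝓕.le t) hZΩ.comap_le) le_sup_left
      ((comap_measurable (Z t)).mono le_sup_right le_rfl) (h.measurable_param t ht) (h.ae_norm ht)
      ((h.measurable_param (t + 1) (by omega)).mono (𝓕.le _) le_rfl)
      ((h.measurable_noise t ht).mono (𝓕.le _) le_rfl) (h.isUniformOrth ht) (h.noise_mean t ht)
      (h.noise_integrable t ht) (h.noise_subgaussian t ht) (hσ0 t ht) (hσ t ht) (hη t ht)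
      (hl (t + 1) (by omega)) (h.update t ht) (hlη t ht) (hlη' t ht) (hll t ht) (hAmeas t ht)
      (fun ω hω => by linarith [hω t ht le_rfl, hbγ t ht])
  -- the exponential moment of the loss on the event that no bound has been violated so far
  have hmoment (t : ℕ) (ht : 1 ≤ t) :
      ∫ ω in A t, Real.exp (l t * (1 - inner ℝ θs (θ t ω))) ∂μ ≤ Real.exp (B t) ∧
      ∫ ω in A t, Real.exp (l (t + 1) * (1 - inner ℝ θs (θ (t + 1) ω))) ∂μ
        ≤ Real.exp (B (t + 1)) := by
    have hstep (t : ℕ) (ht : 1 ≤ t)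
        (hle : ∫ ω in A t, Real.exp (l t * (1 - inner ℝ θs (θ t ω))) ∂μ ≤ Real.exp (B t)) :
        ∫ ω in A t, Real.exp (l (t + 1) * (1 - inner ℝ θs (θ (t + 1) ω))) ∂μ
          ≤ Real.exp (B (t + 1)) := by
      refine (hround t ht).2.trans ((mul_le_mul_of_nonneg_left hle (Real.exp_pos _).le).trans ?_)
      rw [← Real.exp_add]
      exact Real.exp_le_exp.2 (by linarith [hB t ht])
    induction t, ht using Nat.le_induction with
    | base =>
      refine (fun h1 => ⟨h1, hstep 1 le_rfl h1⟩) ?_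
      have hbound : ∀ᵐ ω ∂(μ.restrict (A 1)),
          Real.exp (l 1 * (1 - inner ℝ θs (θ 1 ω))) ≤ Real.exp (B 1) := by
        filter_upwards [ae_restrict_of_ae hinit] with ω hω
        refine Real.exp_le_exp.2 (le_trans ?_ hB1)
        exact mul_le_mul_of_nonneg_left (by linarith) (hl 1 le_rfl)
      calc _ ≤ ∫ ω in A 1, Real.exp (B 1) ∂μ :=
            integral_mono_of_nonneg (.of_forall fun _ => (Real.exp_pos _).le)
              (integrable_const _) hbound
        _ = μ.real (A 1) * Real.exp (B 1) := by simp
        _ ≤ _ := mul_le_of_le_one_left (Real.exp_pos _).le measureReal_le_one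
    | succ t ht ih =>
      refine (fun h1 => ⟨h1, hstep (t + 1) (by omega) h1⟩) ((setIntegral_mono_set
        (hround t ht).1 (.of_forall fun _ => (Real.exp_pos _).le) ?_).trans ih.2)
      rw [hAsucc t ht]
      exact inter_subset_left.eventuallyLE
  have hfail (t : ℕ) (ht : 1 ≤ t) : μ.real (A t) ≤ μ.real (A (t + 1)) + δ := by
    have hsplit : A t ⊆ A (t + 1) ∪ (A t ∩ {ω | b (t + 1) ≤ 1 - inner ℝ θs (θ (t + 1) ω)}) := by
      intro ω hω
      rw [hAsucc t ht]
      rcases le_total (1 - inner ℝ θs (θ (t + 1) ω)) (b (t + 1)) with h1 | h1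
      · exact .inl ⟨hω, h1⟩
      · exact .inr ⟨hω, h1⟩
    refine (measureReal_mono hsplit).trans ((measureReal_union_le _ _).trans ?_)
    gcongr
    have hmarkov := mul_meas_ge_le_integral_of_nonneg (μ := μ.restrict (A t))
      (.of_forall fun _ => (Real.exp_pos _).le) (hround t ht).1
      (Real.exp (l (t + 1) * b (t + 1)))
    have hsub : A t ∩ {ω | b (t + 1) ≤ 1 - inner ℝ θs (θ (t + 1) ω)} ⊆
        {ω | Real.exp (l (t + 1) * b (t + 1))
          ≤ Real.exp (l (t + 1) * (1 - inner ℝ θs (θ (t + 1) ω)))} ∩ A t := fun ω hω =>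
      ⟨Real.exp_le_exp.2 (mul_le_mul_of_nonneg_left hω.2 (hl _ (by omega))), hω.1⟩
    rw [measureReal_restrict_apply' (𝓕.le t _ (hAmeas t ht))] at hmarkov
    have hle := mul_le_mul_of_nonneg_left (measureReal_mono (μ := μ) hsub)
      (Real.exp_pos (l (t + 1) * b (t + 1))).le
    have hexp : Real.exp (B (t + 1)) ≤ Real.exp (l (t + 1) * b (t + 1)) * δ := by
      have hb' := hb (t + 1) (by omega)
      rw [one_div, Real.log_inv] at hb'
      calc _ ≤ Real.exp (l (t + 1) * b (t + 1) + Real.log δ) :=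
            Real.exp_le_exp.2 (by linarith)
        _ = _ := by rw [Real.exp_add, Real.exp_log hδ]
    exact le_of_mul_le_mul_left (hle.trans (hmarkov.trans ((hmoment t ht).2.trans hexp)))
      (Real.exp_pos _)
  have hmain : 1 - δ * (T - 1) ≤ μ.real (A T) := by
    induction T, hT using Nat.le_induction with
    | base =>
      have hae : A 1 =ᵐ[μ] univ := by
        rw [hA1]
        refine Filter.eventuallyEq_univ.2 ?_
        filter_upwards [hinit] with ω hω
        show 1 - inner ℝ θs (θ 1 ω) ≤ b 1
        linarith
      have : μ.real (A 1) = 1 := by rw [measureReal_congr hae, probReal_univ]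
      simp [this]
    | succ t ht ih =>
      have := hfail t ht
      push_cast
      linarith
  linarith

/-- Confinement for schedules with `η t * σ t ^ 2 = 2 d / (γ₁² (t + n))`. With the weights
`l t = c / η t`, one round contracts the exponent by the factor `1 - 1 / (t + n)`, and the second
order terms of the rounds up to `t` add up to `J d log ((t + n) / (1 + n))`. -/
theorem exists_confinement_constants {γ₁ γ₂ : ℝ} (hγ₁ : 0 < γ₁) (hγ₂ : 0 < γ₂) :
    ∃ c J : ℝ, 0 < c ∧ 0 < J ∧ ∀ {d : ℕ} {Ω : Type*} [mΩ : MeasurableSpace Ω] {μ : Measure Ω}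
      [IsProbabilityMeasure μ] {𝓕 : Filtration ℕ mΩ} {f : ℝ → ℝ}
      {θs : EuclideanSpace ℝ (Fin d)} {η σ : ℕ → ℝ} {θ Z : ℕ → Ω → EuclideanSpace ℝ (Fin d)}
      {ξ : ℕ → Ω → ℝ} {γ₀ : ℝ}, IsInteractiveSGD μ 𝓕 f θs η σ θ Z ξ → IsLink γ₀ γ₁ γ₂ f →
      0 < γ₀ → γ₀ ≤ 1 / 10 → 2 ≤ d → ‖θs‖ = 1 →
      (∀ᵐ ω ∂μ, 1 - γ₀ / 4 ≤ inner ℝ θs (θ 1 ω)) → ∀ {δ n ℓ : ℝ}, 0 < δ → 0 ≤ n →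
      0 ≤ ℓ → Real.log (1 / δ) ≤ ℓ → (∀ t, 1 ≤ t → 0 ≤ σ t) → (∀ t, 1 ≤ t → σ t ≤ γ₀ / 4) →
      (∀ t, 1 ≤ t → 0 < η t) → (∀ t, 1 ≤ t → η t ≤ η 1) → (∀ t, 1 ≤ t → η t ≤ 2 * η (t + 1)) →
      (∀ t : ℕ, 1 ≤ t → η t * (1 - 1 / (t + n)) ≤ η (t + 1)) →
      (∀ t : ℕ, 1 ≤ t → η t * σ t ^ 2 = 2 / γ₁ ^ 2 * (d / (t + n))) →
      (∀ t : ℕ, 1 ≤ t → η t / c * (J * d * Real.log ((t + n) / (1 + n)) + ℓ) ≤ γ₀ / 4) →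
      ∀ {T : ℕ}, 1 ≤ T → 1 - δ * T ≤ μ.real {ω | ∀ t : ℕ, 1 ≤ t → t ≤ T →
        1 - inner ℝ θs (θ t ω) ≤ η t / η 1 * (γ₀ / 4)
          + η t / c * (J * d * Real.log ((t + n) / (1 + n)) + ℓ)} := by
  -- The weights change by a factor at most `2` per round, so `l (t + 1) * η t ≤ 2 c`.
  set c : ℝ := min (1 / (8 * γ₂)) (γ₁ / (80 * Real.exp 6 * γ₂)) with hc
  have hc0 : 0 < c := by positivity
  have hc1 : 2 * c * γ₂ ≤ 1 / 4 := by
    have := min_le_left (1 / (8 * γ₂)) (γ₁ / (80 * Real.exp 6 * γ₂))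
    rw [← hc, le_div_iff₀ (by positivity)] at this
    linarith
  have hc2 : 20 * Real.exp 6 * (2 * c * γ₂) ≤ γ₁ / 2 := by
    have := min_le_right (1 / (8 * γ₂)) (γ₁ / (80 * Real.exp 6 * γ₂))
    rw [← hc, le_div_iff₀ (by positivity)] at this
    linarith
  refine ⟨c, 160 * Real.exp 6 * γ₂ ^ 2 * c / γ₁ ^ 2, hc0, by positivity, ?_⟩
  set J := 160 * Real.exp 6 * γ₂ ^ 2 * c / γ₁ ^ 2 with hJ
  intro d Ω mΩ μ _ 𝓕 f θs η σ θ Z ξ γ₀ h hf h0 h0' hd hθs hinit δ n ℓ hδ hn hℓ hδℓ hσ0 hσ hη hη1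
    hη2 hηN hησ hsmall T hT
  have hd0 : (0 : ℝ) < d := by
    have : (2 : ℝ) ≤ d := by exact_mod_cast hd
    linarith
  have hN (t : ℕ) (ht : 1 ≤ t) : (0 : ℝ) < t + n := by
    have : (1 : ℝ) ≤ t := by exact_mod_cast ht
    linarith
  have hlη (t : ℕ) (ht : 1 ≤ t) : c / η (t + 1) * η t ≤ 2 * c := by
    rw [div_mul_eq_mul_div, div_le_iff₀ (hη _ (by omega))]
    nlinarith [hη2 t ht]
  refine h.confined hf h0' hγ₁ hγ₂ hd hθs hinit hδ (l := fun t => c / η t)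
    (B := fun t => c / η 1 * (γ₀ / 4) + J * d * Real.log ((t + n) / (1 + n))) hσ0 hσ
    (fun t ht => (hη t ht).le) (fun t ht => div_nonneg hc0.le (hη t ht).le) (fun t ht => ?_)
    (fun t ht => ?_) (fun t ht => ?_) ?_ (fun t ht => ?_) ?_ (fun t ht => ?_) (fun t ht => ?_) hT
  · exact (mul_le_mul_of_nonneg_right (hlη t ht) hγ₂.le).trans hc1
  · exact (mul_le_mul_of_nonneg_left (mul_le_mul_of_nonneg_right (hlη t ht) hγ₂.le)
      (by positivity)).trans hc2
  · have e : γ₁ ^ 2 * η t * σ t ^ 2 / (2 * d) = 1 / (t + n) := by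
      rw [mul_assoc, hησ t ht]
      have := (hN t ht).ne'
      field_simp
    rw [e, div_mul_eq_mul_div, div_le_div_iff₀ (hη _ (by omega)) (hη t ht)]
    nlinarith [hηN t ht]
  · have : (1 : ℝ) + n ≠ 0 := by positivity
    simp [this]
  · have hN0 := hN t ht
    have hlog : 1 / (2 * (t + n)) ≤ Real.log ((t + 1 + n) / (t + n)) := by
      have h1 := Real.one_sub_inv_le_log_of_pos (by positivity : 0 < (t + 1 + n) / (t + n))
      refine le_trans ?_ h1
      rw [inv_div, one_sub_div (by positivity), div_le_div_iff₀ (by positivity) (by positivity)]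
      have : (1 : ℝ) ≤ t := by exact_mod_cast ht
      nlinarith
    have hsplit : Real.log ((t + 1 + n) / (1 + n))
        = Real.log ((t + n) / (1 + n)) + Real.log ((t + 1 + n) / (t + n)) := by
      rw [← Real.log_mul (by positivity) (by positivity)]
      congr 1
      field_simp
    push_cast
    rw [hsplit, mul_add, ← add_assoc]
    refine add_le_add le_rfl ?_
    calc 20 * Real.exp 6 * γ₂ ^ 2 * (c / η (t + 1) * η t ^ 2 * σ t ^ 2)
        = 20 * Real.exp 6 * γ₂ ^ 2 * ((c / η (t + 1) * η t) * (η t * σ t ^ 2)) := by ring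
      _ ≤ 20 * Real.exp 6 * γ₂ ^ 2 * (2 * c * (2 / γ₁ ^ 2 * (d / (t + n)))) := by
        rw [hησ t ht]
        exact mul_le_mul_of_nonneg_left (mul_le_mul_of_nonneg_right (hlη t ht) (by positivity))
          (by positivity)
      _ = J * d * (1 / (2 * (t + n))) := by rw [hJ]; field_simp; norm_num
      _ ≤ _ := by gcongr
  · have : (1 : ℝ) + n ≠ 0 := by positivity
    have h1 := hη 1 le_rfl
    simp only [Nat.cast_one, div_self this, Real.log_one, mul_zero, zero_add, div_self h1.ne',
      one_mul]
    have : 0 ≤ η 1 / c * ℓ := by positivity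
    linarith
  · have h1 : η t / η 1 * (γ₀ / 4) ≤ 1 * (γ₀ / 4) := by
      gcongr
      exact div_le_one_of_le₀ (hη1 t ht) (hη 1 le_rfl).le
    linarith [hsmall t ht]
  · have h1 := (hη t ht).ne'
    have h2 := (hη 1 le_rfl).ne'
    have e : c / η t * (η t / η 1 * (γ₀ / 4)
        + η t / c * (J * d * Real.log ((t + n) / (1 + n)) + ℓ))
        = c / η 1 * (γ₀ / 4) + (J * d * Real.log ((t + n) / (1 + n)) + ℓ) := by
      field_simp
    rw [e]
    linarith

end Trajectory

/-! ### Logarithmic factors -/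

section Logarithms

lemma one_le_log_exp_one_add {x : ℝ} (hx : 0 ≤ x) : 1 ≤ Real.log (Real.exp 1 + x) := by
  rw [Real.le_log_iff_exp_le (by positivity)]
  linarith

lemma log_exp_one_add_mono {x y : ℝ} (hx : 0 ≤ x) (hxy : x ≤ y) :
    Real.log (Real.exp 1 + x) ≤ Real.log (Real.exp 1 + y) :=
  Real.log_le_log (by positivity) (by linarith)

lemma log_exp_one_add_mul_le {x y : ℝ} (hx : 0 ≤ x) (hy : 0 ≤ y) :
    Real.log (Real.exp 1 + x * y) ≤ Real.log (Real.exp 1 + x) + Real.log (Real.exp 1 + y) := by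
  rw [← Real.log_mul (by positivity) (by positivity)]
  refine Real.log_le_log (by positivity) ?_
  have : 1 ≤ Real.exp 1 := Real.one_le_exp zero_le_one
  nlinarith [mul_nonneg (Real.exp_pos 1).le hx, mul_nonneg (Real.exp_pos 1).le hy]

/-- A lower bound on `T` whose logarithmic factor does not involve `T` suffices to dominate a
logarithm of `T`. -/
lemma exists_log_sq_inversion {P : ℝ} (hP : 0 < P) :
    ∃ C : ℝ, 0 < C ∧ ∀ {d δ ε T : ℝ}, 1 ≤ d → 0 < δ → δ ≤ 1 → 0 < ε → ε ≤ 1 →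
      C * Real.log (Real.exp 1 + d / (ε * δ)) ^ 2 * (d ^ 2 / ε) ≤ T →
      P * d ^ 2 * Real.log (Real.exp 1 + d * T / δ) ^ 2 / T ≤ ε := by
  set a := Real.log (Real.exp 1 + P) + 3 with ha
  have ha0 : 1 ≤ a := by linarith [one_le_log_exp_one_add hP.le]
  -- `u` is the ratio of `T` and `P d² / ε`; the claim becomes `log² (e + d T / δ) ≤ u`, where the
  -- logarithm is at most `log (e + u) + a log (e + d / (ε δ))`
  refine ⟨P * (8192 + 4 * a ^ 2), by positivity, ?_⟩
  intro d δ ε T hd hδ hδ1 hε hε1 hT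
  set w := d / (ε * δ) with hw
  have hw1 : d ≤ w := by
    rw [hw, le_div_iff₀ (by positivity)]
    have := mul_le_one₀ hε1 hδ.le hδ1
    nlinarith
  set Λ := Real.log (Real.exp 1 + w) with hΛ
  have hΛ1 : 1 ≤ Λ := one_le_log_exp_one_add (by linarith)
  have hX : 0 < P * d ^ 2 / ε := by positivity
  obtain ⟨u, hu⟩ : ∃ u, T = u * (P * d ^ 2 / ε) := ⟨T / (P * d ^ 2 / ε), by field_simp⟩
  have hu1 : (8192 + 4 * a ^ 2) * Λ ^ 2 ≤ u := by
    rw [hu] at hT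
    refine le_of_mul_le_mul_right (le_trans (le_of_eq ?_) hT) hX
    ring
  have hΛ2 : 1 ≤ Λ ^ 2 := one_le_pow₀ hΛ1
  have hu2 : 8192 ≤ u := by nlinarith [sq_nonneg a]
  have hT0 : 0 < T := by rw [hu]; positivity
  have hlogw : Real.log (Real.exp 1 + P * (w * (w * w))) ≤ a * Λ := by
    have hw0 : 0 ≤ w := by linarith
    have h1 := log_exp_one_add_mul_le hP.le (mul_nonneg hw0 (mul_nonneg hw0 hw0))
    have h2 := log_exp_one_add_mul_le hw0 (mul_nonneg hw0 hw0)
    have h3 := log_exp_one_add_mul_le hw0 hw0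
    have h4 : Real.log (Real.exp 1 + P) ≤ Real.log (Real.exp 1 + P) * Λ :=
      le_mul_of_one_le_right (by linarith [one_le_log_exp_one_add hP.le]) hΛ1
    rw [ha]; linarith
  have hlogT : Real.log (Real.exp 1 + d * T / δ) ≤ Real.log (Real.exp 1 + u) + a * Λ := by
    have e : d * T / δ = u * (P * (d ^ 2 * w)) := by rw [hu, hw]; field_simp
    rw [e]
    refine (log_exp_one_add_mul_le (by linarith) (by positivity)).trans ?_
    gcongr
    refine le_trans (log_exp_one_add_mono (by positivity) ?_) hlogw
    have : d ^ 2 ≤ w * w := by nlinarith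
    calc P * (d ^ 2 * w) ≤ P * (w * w * w) := by gcongr
      _ = _ := by ring
  have hlogu : Real.log (Real.exp 1 + u) ^ 2 ≤ u / 4 := by
    have he : Real.exp 1 ≤ 3 := by linarith [Real.exp_one_lt_d9]
    have hy : 0 < Real.exp 1 + u := by positivity
    have h1 : Real.log (Real.exp 1 + u) ≤ 4 * √√(Real.exp 1 + u) := by
      have h2 := Real.log_le_self (Real.sqrt_nonneg √(Real.exp 1 + u))
      rw [Real.log_sqrt (Real.sqrt_nonneg _), Real.log_sqrt hy.le] at h2
      linarith
    have h3 : Real.log (Real.exp 1 + u) ^ 2 ≤ 16 * √(Real.exp 1 + u) := by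
      have := pow_le_pow_left₀ (by linarith [one_le_log_exp_one_add (by linarith : 0 ≤ u)]) h1 2
      rw [mul_pow, Real.sq_sqrt (Real.sqrt_nonneg _)] at this
      linarith
    have h4 : √(Real.exp 1 + u) ≤ u / 64 :=
      Real.sqrt_le_iff.2 ⟨by positivity, by nlinarith⟩
    linarith
  have hlog0 : 0 ≤ Real.log (Real.exp 1 + d * T / δ) := by
    linarith [one_le_log_exp_one_add (by positivity : 0 ≤ d * T / δ)]
  have hfinal : Real.log (Real.exp 1 + d * T / δ) ^ 2 ≤ u := by
    have h1 := pow_le_pow_left₀ hlog0 hlogT 2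
    nlinarith [sq_nonneg (Real.log (Real.exp 1 + u) - a * Λ)]
  rw [div_le_iff₀ hT0]
  calc P * d ^ 2 * Real.log (Real.exp 1 + d * T / δ) ^ 2 ≤ P * d ^ 2 * u := by gcongr
    _ = ε * T := by rw [hu]; field_simp

/-- A schedule `κ a / n`, where `n` exceeds `R` by at most a logarithmic factor, is of order
`a / R`. -/
lemma thetaWithin_div {κ a n R Q C L : ℝ} (hκ : 0 < κ) (ha : 0 ≤ a) (hR : 0 < R)
    (hL : 1 ≤ L) (hRn : R ≤ n) (hn : n ≤ Q * L * R) (hC1 : κ ≤ C) (hC2 : Q / κ ≤ C) :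
    ThetaWithin C L (κ * (a / n)) (a / R) := by
  have hC : 0 < C := hκ.trans_le hC1
  have hn0 : 0 < n := hR.trans_le hRn
  have hL0 : 0 < L := by linarith
  constructor
  · rw [div_div, ← mul_div_assoc, div_le_div_iff₀ (by positivity) hn0]
    rw [div_le_iff₀ hκ] at hC2
    calc a * n ≤ a * (Q * L * R) := by gcongr
      _ ≤ a * (C * κ * L * R) := by gcongr
      _ = _ := by ring
  · have : a / n ≤ a / R := by gcongr
    refine mul_le_mul ?_ this (by positivity) (by positivity)
    nlinarith

end Logarithms

/-! ### The shifted time `t + (M d ℓ)²` -/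

section Schedules

/-- The shifted time agrees with `max t (d ^ 2)` up to a logarithmic factor. -/
lemma shift_bounds {M d δ t : ℝ} (hM : 1 ≤ M) (hd : 1 ≤ d) (hδ : 0 < δ) (ht : 1 ≤ t) :
    max t (d ^ 2) ≤ t + (M * d * Real.log (Real.exp 1 + d / δ)) ^ 2 ∧
    t + (M * d * Real.log (Real.exp 1 + d / δ)) ^ 2
      ≤ 2 * M ^ 2 * polylog 2 (d * t / δ) * max t (d ^ 2) := by
  have hℓ : 1 ≤ Real.log (Real.exp 1 + d / δ) := one_le_log_exp_one_add (by positivity)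
  have hℓΛ : Real.log (Real.exp 1 + d / δ) ≤ Real.log (Real.exp 1 + d * t / δ) :=
    log_exp_one_add_mono (by positivity) (by gcongr; exact le_mul_of_one_le_right (by linarith) ht)
  set ℓ := Real.log (Real.exp 1 + d / δ)
  unfold polylog
  set Λ := Real.log (Real.exp 1 + d * t / δ)
  have hMℓ : 1 ≤ M * ℓ := one_le_mul_of_one_le_of_one_le hM hℓ
  have hMℓ2 : 1 ≤ (M * ℓ) ^ 2 := one_le_pow₀ hMℓ
  have hMΛ : (M * ℓ) ^ 2 ≤ (M * Λ) ^ 2 := by gcongr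
  have hR1 := le_max_left t (d ^ 2)
  have hR2 := le_max_right t (d ^ 2)
  have e : (M * d * ℓ) ^ 2 = d ^ 2 * (M * ℓ) ^ 2 := by ring
  rw [e]
  constructor
  · refine max_le ?_ ?_
    · nlinarith [mul_nonneg (sq_nonneg d) (sq_nonneg (M * ℓ))]
    · nlinarith [mul_le_mul_of_nonneg_left hMℓ2 (sq_nonneg d)]
  · have h1 : t ≤ max t (d ^ 2) * (M * Λ) ^ 2 :=
      hR1.trans (le_mul_of_one_le_right (by linarith) (hMℓ2.trans hMΛ))
    have h2 : d ^ 2 * (M * ℓ) ^ 2 ≤ max t (d ^ 2) * (M * Λ) ^ 2 :=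
      mul_le_mul hR2 hMΛ (by positivity) (by positivity)
    linarith

lemma log_shift_ratio_le {t n : ℝ} (ht : 1 ≤ t) (hn : 0 ≤ n) :
    Real.log ((t + n) / (1 + n)) ≤ Real.log t := by
  refine Real.log_le_log (by positivity) ?_
  rw [div_le_iff₀ (by positivity)]
  nlinarith

/-- For learning rates of order `d / N`: the fluctuation part of the confidence bound is at most
of order `1 / M`. -/
lemma mul_log_ratio_add_le {J d M ℓ N N₁ : ℝ} (hJ : 0 ≤ J) (hd : 1 ≤ d) (hM : 1 ≤ M) (hℓ : 1 ≤ ℓ)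
    (hN₁ : (M * d * ℓ) ^ 2 ≤ N₁) (hN : N₁ ≤ N) :
    d * (J * d * Real.log (N / N₁) + ℓ) ≤ (J + 1) * (N / M) := by
  have hY : 1 ≤ M * d * ℓ :=
    one_le_mul_of_one_le_of_one_le (one_le_mul_of_one_le_of_one_le hM hd) hℓ
  have hN₁0 : 0 < N₁ := by nlinarith
  have hN0 : 0 < N := hN₁0.trans_le hN
  have h1 : d * d * Real.log (N / N₁) ≤ N / M := by
    have hlog : Real.log (N / N₁) ≤ N / N₁ := Real.log_le_self (by positivity)
    have hcmp : N / N₁ ≤ N / (M * d ^ 2) := by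
      gcongr
      refine le_trans ?_ hN₁
      have h2 : 1 ≤ M * ℓ ^ 2 := one_le_mul_of_one_le_of_one_le hM (one_le_pow₀ hℓ)
      have h3 := mul_le_mul_of_nonneg_left h2 (by positivity : 0 ≤ M * d ^ 2)
      calc M * d ^ 2 = M * d ^ 2 * 1 := (mul_one _).symm
        _ ≤ _ := h3
        _ = _ := by ring
    calc d * d * Real.log (N / N₁) ≤ d * d * (N / (M * d ^ 2)) := by
          gcongr; exact hlog.trans hcmp
      _ = N / M := by field_simp
  have h2 : d * ℓ ≤ N / M := by
    rw [le_div_iff₀ (by positivity)]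
    nlinarith
  have := mul_le_mul_of_nonneg_left h1 hJ
  linarith

/-- For learning rates of order `1 / √N`: the fluctuation part of the confidence bound is at most
of order `1 / M`. -/
lemma log_ratio_add_le_sqrt {J d M ℓ N N₁ : ℝ} (hJ : 0 ≤ J) (hd : 1 ≤ d) (hM : 1 ≤ M)
    (hℓ : 1 ≤ ℓ) (hN₁ : (M * d * ℓ) ^ 2 ≤ N₁) (hN : N₁ ≤ N) :
    J * d * Real.log (N / N₁) + ℓ ≤ 2 * (J + 1) * (√N / M) := by
  have hY : 1 ≤ M * d * ℓ :=
    one_le_mul_of_one_le_of_one_le (one_le_mul_of_one_le_of_one_le hM hd) hℓ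
  have hN₁0 : 0 < N₁ := by nlinarith
  have hN0 : 0 < N := hN₁0.trans_le hN
  have hsqrt : M * d * ℓ ≤ √N₁ := Real.le_sqrt_of_sq_le hN₁
  have hs0 : 0 < √N := Real.sqrt_pos.2 hN0
  have h1 : d * Real.log (N / N₁) ≤ 2 * (√N / M) := by
    have hlog : Real.log (N / N₁) ≤ 2 * (√N / √N₁) := by
      have := Real.log_le_self (Real.sqrt_nonneg (N / N₁))
      rw [Real.log_sqrt (by positivity), Real.sqrt_div hN0.le] at this
      linarith
    have hcmp : √N / √N₁ ≤ √N / (M * d) := by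
      gcongr
      exact (le_mul_of_one_le_right (by positivity) hℓ).trans hsqrt
    calc d * Real.log (N / N₁) ≤ d * (2 * (√N / (M * d))) := by
          gcongr; exact hlog.trans (by linarith)
      _ = 2 * (√N / M) := by field_simp
  have h2 : ℓ ≤ √N / M := by
    rw [le_div_iff₀ (by positivity)]
    have h3 := Real.sqrt_le_sqrt hN
    nlinarith [mul_le_mul_of_nonneg_left hd (by positivity : 0 ≤ M * ℓ)]
  have h3 := mul_le_mul_of_nonneg_left h1 hJ
  have h4 : 0 ≤ √N / M := by positivity
  linarith

lemma min_div_div {d t : ℝ} (hd : 0 < d) (ht : 0 < t) :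
    min (d / t) (1 / d) = d / max t (d ^ 2) := by
  have e : 1 / d = d / d ^ 2 := by field_simp
  rw [e]
  rcases le_total t (d ^ 2) with h | h
  · rw [max_eq_right h, min_eq_right (by gcongr)]
  · rw [max_eq_left h, min_eq_left (by gcongr)]

lemma min_div_sqrt {a d t : ℝ} (ha : 0 ≤ a) (hd : 0 < d) (ht : 0 < t) :
    min (a / √t) (a / d) = a / √(max t (d ^ 2)) := by
  have e : a / d = a / √(d ^ 2) := by rw [Real.sqrt_sq hd.le]
  rw [e]
  rcases le_total t (d ^ 2) with h | h
  · rw [max_eq_right h, min_eq_right (by gcongr)]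
  · rw [max_eq_left h, min_eq_left (by gcongr)]

lemma sum_Icc_one_div_sqrt_le (T : ℕ) :
    ∑ t ∈ Finset.Icc 1 T, 1 / √(t : ℝ) ≤ 2 * √(T : ℝ) := by
  induction T with
  | zero => simp
  | succ T ih =>
    rw [Finset.sum_Icc_succ_top (by omega)]
    have h1 : 0 < √((T + 1 : ℕ) : ℝ) := Real.sqrt_pos.2 (by positivity)
    have h2 : √(T : ℝ) ^ 2 = T := Real.sq_sqrt (by positivity)
    have h3 : √((T + 1 : ℕ) : ℝ) ^ 2 = T + 1 := by rw [Real.sq_sqrt (by positivity)]; push_cast; rfl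
    have h4 : 1 / √((T + 1 : ℕ) : ℝ) ≤ 2 * √((T + 1 : ℕ) : ℝ) - 2 * √(T : ℝ) := by
      rw [div_le_iff₀ h1]
      nlinarith [sq_nonneg (√((T + 1 : ℕ) : ℝ) - √(T : ℝ))]
    linarith

lemma log_one_div_le {d δ : ℝ} (hd : 1 ≤ d) (hδ : 0 < δ) :
    Real.log (1 / δ) ≤ Real.log (Real.exp 1 + d / δ) := by
  refine Real.log_le_log (by positivity) ?_
  have : 1 / δ ≤ d / δ := by gcongr
  linarith [Real.exp_pos 1]

lemma log_le_log_exp_one_add {d δ t : ℝ} (hd : 1 ≤ d) (hδ : 0 < δ) (hδ1 : δ ≤ 1) (ht : 1 ≤ t) :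
    Real.log t ≤ Real.log (Real.exp 1 + d * t / δ) := by
  refine Real.log_le_log (by linarith) ?_
  have : t ≤ d * t / δ := by
    rw [le_div_iff₀ hδ]
    nlinarith [mul_le_mul_of_nonneg_left hδ1 (by linarith : 0 ≤ t)]
  linarith [Real.exp_pos 1]

/-- In case `δ ≥ 1` the claimed probability is not positive. -/
lemma one_sub_mul_le_measureReal {Ω : Type*} [MeasurableSpace Ω] {μ : Measure Ω} {δ : ℝ} {T : ℕ}
    (hT : 1 ≤ T) {S : Set Ω} (h : δ ≤ 1 → 1 - δ * T ≤ μ.real S) : 1 - δ * T ≤ μ.real S := by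
  rcases le_total δ 1 with hδ | hδ
  · exact h hδ
  · have : (1 : ℝ) ≤ T := by exact_mod_cast hT
    exact le_trans (by nlinarith) measureReal_nonneg

/-- Learning rates proportional to `1 / N` decay no faster than the contraction allows. -/
lemma one_sub_inv_mul_inv_le {N : ℝ} (hN : 1 ≤ N) : (1 - 1 / N) / N ≤ 1 / (N + 1) := by
  have : 0 < N := by linarith
  rw [one_sub_div this.ne', div_div, div_le_div_iff₀ (by positivity) (by positivity)]
  nlinarith

/-- Learning rates proportional to `1 / √N` decay no faster than the contraction allows. -/
lemma one_sub_inv_mul_inv_sqrt_le {N : ℝ} (hN : 1 ≤ N) : (1 - 1 / N) / √N ≤ 1 / √(N + 1) := by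
  have h0 : 0 < N := by linarith
  have h1 : 0 < √(N + 1) := Real.sqrt_pos.2 (by linarith)
  rw [div_le_div_iff₀ (Real.sqrt_pos.2 h0) h1, one_mul]
  refine Real.le_sqrt_of_sq_le ?_
  rw [mul_pow, Real.sq_sqrt (by linarith), one_sub_div h0.ne', div_pow, div_mul_eq_mul_div,
    div_le_iff₀ (by positivity)]
  nlinarith

end Schedules

/-! ### Pure exploration -/

/-- Constant exploration `γ₀ / 4` and learning rates `K d / N`: the confidence bound at time `T` is
`P d² log² (e + d T / δ) / T`, which is at most `ε` for the prescribed `T`. -/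
theorem pure_exploration {γ₀ γ₁ γ₂ : ℝ} (hγ₀ : 0 < γ₀) (hγ₀' : γ₀ ≤ 1 / 10) (hγ₁ : 0 < γ₁)
    (hγ₂ : 0 < γ₂) :
    ∃ (s C : ℝ) (k : ℕ), 0 < s ∧ s ≤ 1 ∧ 0 < C ∧
      ∀ d : ℕ, 2 ≤ d → ∀ δ : ℝ, 0 < δ →
        ∃ η : ℕ → ℝ,
          (∀ t : ℕ, 1 ≤ t →
            ThetaWithin C (polylog k (d * t / δ)) (η t) (min ((d : ℝ) / t) (1 / d))) ∧
          ∀ f : ℝ → ℝ, IsLink γ₀ γ₁ γ₂ f →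
          ∀ θs : EuclideanSpace ℝ (Fin d), ‖θs‖ = 1 →
          ∀ (Ω : Type*) [mΩ : MeasurableSpace Ω] (μ : Measure Ω) [IsProbabilityMeasure μ]
            (𝓕 : Filtration ℕ mΩ) (θ Z : ℕ → Ω → EuclideanSpace ℝ (Fin d)) (ξ : ℕ → Ω → ℝ),
          IsInteractiveSGD μ 𝓕 f θs η (fun _ => s) θ Z ξ →
          (∀ᵐ ω ∂μ, 1 - γ₀ / 4 ≤ inner ℝ θs (θ 1 ω)) →
          ∀ ε : ℝ, 0 < ε →
          ∀ T : ℕ, 1 ≤ T → C * polylog k (d / (ε * δ)) * ((d : ℝ) ^ 2 / ε) ≤ T →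
            1 - δ * T ≤ μ.real {ω | 1 - ε ≤ inner ℝ θs (θ T ω)} := by
  obtain ⟨c, J, hc, hJ, hconf⟩ := exists_confinement_constants hγ₁ hγ₂
  set s := γ₀ / 4 with hs
  have hs0 : 0 < s := by positivity
  -- chosen such that one round contracts the exponent by exactly `1 - 1 / N`
  set K := 2 / (γ₁ ^ 2 * s ^ 2) with hK
  have hK0 : 0 < K := by positivity
  -- large enough for the fluctuation part of the confidence bound to stay below `γ₀ / 4`
  set M := max 1 (4 * K * (J + 1) / (c * γ₀)) with hM
  have hM1 : 1 ≤ M := le_max_left _ _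
  have hM2 : 4 * K * (J + 1) ≤ M * (c * γ₀) := by
    rw [← div_le_iff₀ (by positivity)]; exact le_max_right _ _
  set P := (1 + M ^ 2) * (γ₀ / 4) + K * (J + 1) / c with hP
  have hP0 : 0 < P := by positivity
  obtain ⟨C₀, hC₀, hinv⟩ := exists_log_sq_inversion hP0
  refine ⟨s, K + 2 * M ^ 2 / K + C₀, 2, hs0, by linarith, by positivity, fun d hd δ hδ => ?_⟩
  have hd1 : (1 : ℝ) ≤ d := by exact_mod_cast (by omega : 1 ≤ d)
  have hd0 : (0 : ℝ) < d := by linarith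
  set ℓ := Real.log (Real.exp 1 + d / δ) with hℓ
  have hℓ1 : 1 ≤ ℓ := one_le_log_exp_one_add (by positivity)
  set n := (M * d * ℓ) ^ 2 with hn
  have hn0 : 0 ≤ n := by positivity
  have ht1 {t : ℕ} (ht : 1 ≤ t) : (1 : ℝ) ≤ t := by exact_mod_cast ht
  have hC1 : K ≤ K + 2 * M ^ 2 / K + C₀ := by
    have : 0 ≤ 2 * M ^ 2 / K := by positivity
    linarith
  have hC2 : 2 * M ^ 2 / K ≤ K + 2 * M ^ 2 / K + C₀ := by linarith
  refine ⟨fun t => K * (d / (t + n)), fun t ht => ?_, ?_⟩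
  · rw [min_div_div hd0 (by linarith [ht1 ht])]
    have hb := shift_bounds hM1 hd1 hδ (ht1 ht)
    exact thetaWithin_div hK0 hd0.le (lt_max_of_lt_right (by positivity))
      (one_le_pow₀ (one_le_log_exp_one_add (by positivity))) hb.1 hb.2 hC1 hC2
  intro f hf θs hθs Ω mΩ μ _ 𝓕 θ Z ξ h hinit ε hε T hT hTε
  refine one_sub_mul_le_measureReal hT fun hδ1 => ?_
  have hsmall (t : ℕ) (ht : 1 ≤ t) :
      K * (d / (t + n)) / c * (J * d * Real.log ((t + n) / (1 + n)) + ℓ) ≤ γ₀ / 4 := by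
    have ht' := ht1 ht
    have hN : 0 < t + n := by linarith
    have h1 := mul_log_ratio_add_le (N := t + n) (N₁ := 1 + n) hJ.le hd1 hM1 hℓ1 (by linarith)
      (by linarith)
    calc K * (d / (t + n)) / c * (J * d * Real.log ((t + n) / (1 + n)) + ℓ)
        = K / (c * (t + n)) * (d * (J * d * Real.log ((t + n) / (1 + n)) + ℓ)) := by
          field_simp
      _ ≤ K / (c * (t + n)) * ((J + 1) * ((t + n) / M)) := by gcongr
      _ = K * (J + 1) / (c * M) := by field_simp
      _ ≤ γ₀ / 4 := by
        rw [div_le_iff₀ (by positivity)]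
        linarith
  have hev := hconf h hf hγ₀ hγ₀' hd hθs hinit hδ hn0 (by linarith : 0 ≤ ℓ)
    (log_one_div_le hd1 hδ) (fun _ _ => hs0.le) (fun _ _ => le_rfl)
    (fun t ht => by have := ht1 ht; positivity)
    (fun t ht => by
      have := ht1 ht
      simp only [Nat.cast_one]
      gcongr)
    (fun t ht => by
      have := ht1 ht
      push_cast
      rw [mul_left_comm, ← mul_div_assoc 2]
      refine mul_le_mul_of_nonneg_left ?_ hK0.le
      rw [div_le_div_iff₀ (by positivity) (by positivity)]
      nlinarith)
    (fun t ht => by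
      have := ht1 ht
      push_cast
      have h1 := mul_le_mul_of_nonneg_left (one_sub_inv_mul_inv_le (by linarith : 1 ≤ t + n))
        (by positivity : 0 ≤ K * d)
      calc K * (d / (t + n)) * (1 - 1 / (t + n)) = K * d * ((1 - 1 / (t + n)) / (t + n)) := by ring
        _ ≤ K * d * (1 / (t + n + 1)) := h1
        _ = _ := by rw [add_right_comm]; ring)
    (fun t ht => by
      rw [hK]; field_simp)
    hsmall hT
  refine hev.trans (measureReal_mono fun ω hω => ?_)
  have hω' := hω T hT le_rfl
  have hT1 := ht1 hT
  have hN : 0 < T + n := by linarith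
  have hratio : K * (d / (T + n)) / (K * (d / ((1 : ℕ) + n))) = (1 + n) / (T + n) := by
    push_cast
    field_simp
  rw [hratio] at hω'
  rw [mem_ofPred_eq]
  rcases le_total ε 1 with hε1 | hε1
  · set Λ := Real.log (Real.exp 1 + d * T / δ) with hΛ
    have hℓΛ : ℓ ≤ Λ := log_exp_one_add_mono (by positivity)
      (by gcongr; exact le_mul_of_one_le_right hd0.le hT1)
    have hΛ1 : 1 ≤ Λ := hℓ1.trans hℓΛ
    have hΛ2 : Λ ≤ Λ ^ 2 := le_self_pow₀ hΛ1 two_ne_zero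
    have hΛT : Real.log ((T + n) / (1 + n)) ≤ Λ :=
      (log_shift_ratio_le hT1 hn0).trans (log_le_log_exp_one_add hd1 hδ hδ1 hT1)
    have hn1 : 1 + n ≤ (1 + M ^ 2) * (d ^ 2 * Λ ^ 2) := by
      have h1 : (d * ℓ) ^ 2 ≤ (d * Λ) ^ 2 := by gcongr
      have h2 : 1 ≤ (d * Λ) ^ 2 := one_le_pow₀ (one_le_mul_of_one_le_of_one_le hd1 hΛ1)
      have h3 := mul_le_mul_of_nonneg_left h1 (sq_nonneg M)
      have h4 : n = M ^ 2 * (d * ℓ) ^ 2 := by rw [hn]; ring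
      rw [h4]
      linarith
    have hterm : d * (J * d * Real.log ((T + n) / (1 + n)) + ℓ) ≤ (J + 1) * (d ^ 2 * Λ ^ 2) := by
      have h1 : d * d * Real.log ((T + n) / (1 + n)) ≤ d ^ 2 * Λ ^ 2 := by
        rw [← sq]; gcongr; exact hΛT.trans hΛ2
      have h2 : d * ℓ ≤ d ^ 2 * Λ ^ 2 :=
        mul_le_mul (le_self_pow₀ hd1 two_ne_zero) (hℓΛ.trans hΛ2) (by linarith) (by positivity)
      have := mul_le_mul_of_nonneg_left h1 hJ.le
      linarith
    have hbound : (1 + n) / (T + n) * (γ₀ / 4)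
        + K * (d / (T + n)) / c * (J * d * Real.log ((T + n) / (1 + n)) + ℓ)
        ≤ P * d ^ 2 * Λ ^ 2 / T := by
      calc _ = ((1 + n) * (γ₀ / 4)
            + K / c * (d * (J * d * Real.log ((T + n) / (1 + n)) + ℓ))) / (T + n) := by
            field_simp
        _ ≤ ((1 + M ^ 2) * (d ^ 2 * Λ ^ 2) * (γ₀ / 4)
            + K / c * ((J + 1) * (d ^ 2 * Λ ^ 2))) / (T + n) := by gcongr
        _ = P * d ^ 2 * Λ ^ 2 / (T + n) := by rw [hP]; ring
        _ ≤ _ := by gcongr; linarith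
    have hTε' : C₀ * Real.log (Real.exp 1 + d / (ε * δ)) ^ 2 * ((d : ℝ) ^ 2 / ε) ≤ T := by
      refine le_trans ?_ hTε
      unfold polylog
      gcongr
      have : 0 ≤ 2 * M ^ 2 / K := by positivity
      linarith
    have := hinv hd1 hδ hδ1 hε hε1 hTε'
    linarith
  -- for `ε ≥ 1` confinement to the region `1 - ⟪θs, θ T⟫ ≤ γ₀ / 2` suffices
  · have h1 : (1 + n) / (T + n) ≤ 1 := div_le_one_of_le₀ (by linarith) hN.le
    have h2 := mul_le_mul_of_nonneg_right h1 (by linarith : 0 ≤ γ₀ / 4)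
    have h3 := hsmall T hT
    linarith

/-! ### Regret minimization -/

/-- Holds also for a vanishing half step, which the normalization maps to `0`. -/
lemma norm_sgdStep_le_one {d : ℕ} (f : ℝ → ℝ) (η : ℝ) (θ a : EuclideanSpace ℝ (Fin d)) (r : ℝ) :
    ‖sgdStep f η θ a r‖ ≤ 1 := by
  rw [sgdStep, norm_smul, norm_inv, norm_norm]
  exact inv_mul_le_one

lemma IsInteractiveSGD.inner_le_one {d : ℕ} {Ω : Type*} [mΩ : MeasurableSpace Ω] {μ : Measure Ω}
    {𝓕 : Filtration ℕ mΩ} {f : ℝ → ℝ} {θs : EuclideanSpace ℝ (Fin d)} {η σ : ℕ → ℝ}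
    {θ Z : ℕ → Ω → EuclideanSpace ℝ (Fin d)} {ξ : ℕ → Ω → ℝ}
    (h : IsInteractiveSGD μ 𝓕 f θs η σ θ Z ξ) (hθs : ‖θs‖ = 1) {t : ℕ} (ht : 1 ≤ t) (ω : Ω) :
    inner ℝ θs (θ t ω) ≤ 1 := by
  have hθ : ‖θ t ω‖ ≤ 1 := by
    rcases eq_or_lt_of_le ht with rfl | ht'
    · exact (h.norm_init ω).le
    · obtain ⟨r, rfl⟩ : ∃ r, t = r + 1 := ⟨t - 1, by omega⟩
      rw [h.update r (by omega) ω]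
      exact norm_sgdStep_le_one _ _ _ _ _
  have := real_inner_le_norm θs (θ t ω)
  rw [hθs, one_mul] at this
  exact this.trans hθ

/-- Losses of order `1 / √t` give a regret of order `√T`. -/
lemma IsLink.sum_sub_le {γ₀ γ₁ γ₂ : ℝ} {f : ℝ → ℝ} (hf : IsLink γ₀ γ₁ γ₂ f) (h0 : γ₀ ≤ 1 / 10)
    (hγ₂ : 0 ≤ γ₂) {m : ℕ → ℝ} {B : ℝ} (hB : 0 ≤ B) {T : ℕ}
    (hm : ∀ t, 1 ≤ t → t ≤ T → 1 - γ₀ ≤ m t ∧ m t ≤ 1 ∧ 1 - m t ≤ B * (1 / √(t : ℝ))) :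
    ∑ t ∈ Finset.Icc 1 T, (f 1 - f (m t)) ≤ 2 * γ₂ * B * √(T : ℝ) := by
  calc ∑ t ∈ Finset.Icc 1 T, (f 1 - f (m t))
      ≤ ∑ t ∈ Finset.Icc 1 T, γ₂ * B * (1 / √(t : ℝ)) := by
        refine Finset.sum_le_sum fun t ht => ?_
        obtain ⟨h1, h2, h3⟩ := hm t (Finset.mem_Icc.1 ht).1 (Finset.mem_Icc.1 ht).2
        have := mul_le_mul_of_nonneg_left h3 hγ₂
        linarith [(hf.sub_bounds h0 h1 h2 le_rfl).2]
    _ = γ₂ * B * ∑ t ∈ Finset.Icc 1 T, 1 / √(t : ℝ) := by rw [Finset.mul_sum]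
    _ ≤ γ₂ * B * (2 * √(T : ℝ)) := by gcongr; exact sum_Icc_one_div_sqrt_le T
    _ = _ := by ring

/-- The confidence bound of the regret schedules, where `q = √N`, `r = √t` and `a`, `L` are the
initial part and the logarithmic part. -/
lemma confidence_bound_le {a L g K c M J D r q : ℝ} (hM : 0 ≤ M) (hK : 0 ≤ K) (hc : 0 ≤ c)
    (hg : 0 ≤ g) (hJ : 0 ≤ J) (hD : 0 ≤ D) (hr : 0 < r) (hrq : r ≤ q) (ha : a ≤ (1 + M) * D)
    (hL : L ≤ (J + 1) * D) :
    a / q * g + K * (1 / q) / c * L ≤ ((1 + M) * g + K * (J + 1) / c) * D * (1 / r) := by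
  have hq : 0 < q := hr.trans_le hrq
  calc a / q * g + K * (1 / q) / c * L
      ≤ (1 + M) * D / q * g + K * (1 / q) / c * ((J + 1) * D) := by gcongr
    _ = ((1 + M) * g + K * (J + 1) / c) * D * (1 / q) := by ring
    _ ≤ _ := by gcongr

set_option maxHeartbeats 1000000 in
/-- Learning rates `K / √N` and exploration `σ² = (γ₀ / 4)² d / √N`: the confidence bound at time `t`
is at most `P d log (e + d T / δ) / √t`, which sums to the claimed regret. -/
theorem regret_minimization {γ₀ γ₁ γ₂ : ℝ} (hγ₀ : 0 < γ₀) (hγ₀' : γ₀ ≤ 1 / 10) (hγ₁ : 0 < γ₁)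
    (hγ₂ : 0 < γ₂) :
    ∃ (C : ℝ) (k : ℕ), 0 < C ∧
      ∀ d : ℕ, 2 ≤ d → ∀ δ : ℝ, 0 < δ →
        ∃ η σ : ℕ → ℝ,
          (∀ t : ℕ, 1 ≤ t →
            ThetaWithin C (polylog k (d * t / δ)) (η t) (min (1 / √(t : ℝ)) (1 / d))) ∧
          (∀ t : ℕ, 1 ≤ t → 0 ≤ σ t ∧ σ t ≤ 1 ∧
            ThetaWithin C (polylog k (d * t / δ)) (σ t ^ 2) (min ((d : ℝ) / √(t : ℝ)) 1)) ∧
          ∀ f : ℝ → ℝ, IsLink γ₀ γ₁ γ₂ f →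
          ∀ θs : EuclideanSpace ℝ (Fin d), ‖θs‖ = 1 →
          ∀ (Ω : Type*) [mΩ : MeasurableSpace Ω] (μ : Measure Ω) [IsProbabilityMeasure μ]
            (𝓕 : Filtration ℕ mΩ) (θ Z : ℕ → Ω → EuclideanSpace ℝ (Fin d)) (ξ : ℕ → Ω → ℝ),
          IsInteractiveSGD μ 𝓕 f θs η σ θ Z ξ →
          (∀ᵐ ω ∂μ, 1 - γ₀ / 4 ≤ inner ℝ θs (θ 1 ω)) →
          ∀ T : ℕ, 1 ≤ T →
            1 - δ * T ≤ μ.real {ω | ∑ t ∈ Finset.Icc 1 T, (f 1 - f (inner ℝ θs (θ t ω)))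
              ≤ C * polylog k (d * T / δ) * (d * √(T : ℝ))} := by
  obtain ⟨c, J, hc, hJ, hconf⟩ := exists_confinement_constants hγ₁ hγ₂
  set s := γ₀ / 4 with hs
  have hs0 : 0 < s := by positivity
  -- chosen such that one round contracts the exponent by exactly `1 - 1 / N`
  set K := 2 / (γ₁ ^ 2 * s ^ 2) with hK
  have hK0 : 0 < K := by positivity
  -- large enough for the fluctuation part of the confidence bound to stay below `γ₀ / 4`
  set M := max 1 (8 * K * (J + 1) / (c * γ₀)) with hM
  have hM1 : 1 ≤ M := le_max_left _ _
  have hM2 : 8 * K * (J + 1) ≤ M * (c * γ₀) := by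
    rw [← div_le_iff₀ (by positivity)]; exact le_max_right _ _
  set P := (1 + M) * (γ₀ / 4) + K * (J + 1) / c with hP
  have hP0 : 0 < P := by positivity
  set C := K + 2 * M ^ 2 / K + s ^ 2 + 2 * M ^ 2 / s ^ 2 + 2 * γ₂ * P with hC
  have hQK : 0 < 2 * M ^ 2 / K := by positivity
  have hQs : 0 < 2 * M ^ 2 / s ^ 2 := by positivity
  have hs2 : 0 < s ^ 2 := by positivity
  have hγP : 0 < 2 * γ₂ * P := by positivity
  refine ⟨C, 2, by positivity, fun d hd δ hδ => ?_⟩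
  have hd1 : (1 : ℝ) ≤ d := by exact_mod_cast (by omega : 1 ≤ d)
  have hd0 : (0 : ℝ) < d := by linarith
  set ℓ := Real.log (Real.exp 1 + d / δ) with hℓ
  have hℓ1 : 1 ≤ ℓ := one_le_log_exp_one_add (by positivity)
  set n := (M * d * ℓ) ^ 2 with hn
  have hn0 : 0 ≤ n := by positivity
  have ht1 {t : ℕ} (ht : 1 ≤ t) : (1 : ℝ) ≤ t := by exact_mod_cast ht
  have hsqrt (t : ℕ) (ht : 1 ≤ t) : √(max (t : ℝ) (d ^ 2)) ≤ √(t + n) ∧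
      √(t + n) ≤ 2 * M ^ 2 * polylog 2 (d * t / δ) * √(max (t : ℝ) (d ^ 2)) := by
    have hb := shift_bounds hM1 hd1 hδ (ht1 ht)
    refine ⟨Real.sqrt_le_sqrt hb.1, ?_⟩
    have hL : 1 ≤ polylog 2 (d * t / δ) :=
      one_le_pow₀ (one_le_log_exp_one_add (by positivity))
    have hq : 1 ≤ 2 * M ^ 2 * polylog 2 (d * t / δ) :=
      one_le_mul_of_one_le_of_one_le (by nlinarith) hL
    refine Real.sqrt_le_iff.2 ⟨by positivity, hb.2.trans ?_⟩
    rw [mul_pow, Real.sq_sqrt (by positivity)]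
    gcongr
    exact le_self_pow₀ hq two_ne_zero
  have hdsqrt (t : ℕ) (ht : 1 ≤ t) : (d : ℝ) ≤ √(t + n) := by
    refine le_trans (Real.le_sqrt_of_sq_le ?_) (hsqrt t ht).1
    exact le_max_right _ _
  have hσsq (t : ℕ) : (s * √(d / √(t + n))) ^ 2 = s ^ 2 * (d / √(t + n)) := by
    rw [mul_pow, Real.sq_sqrt (by positivity)]
  have hσs (t : ℕ) (ht : 1 ≤ t) : s * √(d / √(t + n)) ≤ s := by
    refine mul_le_of_le_one_right hs0.le (Real.sqrt_le_one.2 ?_)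
    exact div_le_one_of_le₀ (hdsqrt t ht) (Real.sqrt_nonneg _)
  refine ⟨fun t => K * (1 / √(t + n)), fun t => s * √(d / √(t + n)), fun t ht => ?_,
    fun t ht => ⟨by positivity, (hσs t ht).trans (by linarith), ?_⟩, ?_⟩
  · rw [min_div_sqrt zero_le_one hd0 (by linarith [ht1 ht])]
    exact thetaWithin_div hK0 zero_le_one (Real.sqrt_pos.2 (lt_max_of_lt_right (by positivity)))
      (one_le_pow₀ (one_le_log_exp_one_add (by positivity))) (hsqrt t ht).1 (hsqrt t ht).2
      (by linarith) (by linarith)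
  · have hmin := min_div_sqrt hd0.le hd0 (by linarith [ht1 ht] : (0 : ℝ) < t)
    rw [div_self hd0.ne'] at hmin
    rw [hσsq, hmin]
    exact thetaWithin_div hs2 hd0.le (Real.sqrt_pos.2 (lt_max_of_lt_right (by positivity)))
      (one_le_pow₀ (one_le_log_exp_one_add (by positivity))) (hsqrt t ht).1 (hsqrt t ht).2
      (by linarith) (by linarith)
  intro f hf θs hθs Ω mΩ μ _ 𝓕 θ Z ξ h hinit T hT
  refine one_sub_mul_le_measureReal hT fun hδ1 => ?_
  have hN0 (t : ℕ) (ht : 1 ≤ t) : 0 < √(t + n) := hd0.trans_le (hdsqrt t ht)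
  have hsmall (t : ℕ) (ht : 1 ≤ t) :
      K * (1 / √(t + n)) / c * (J * d * Real.log ((t + n) / (1 + n)) + ℓ) ≤ γ₀ / 4 := by
    have ht' := ht1 ht
    have hN := hN0 t ht
    have h1 := log_ratio_add_le_sqrt (N := t + n) (N₁ := 1 + n) hJ.le hd1 hM1 hℓ1 (by linarith)
      (by linarith)
    calc K * (1 / √(t + n)) / c * (J * d * Real.log ((t + n) / (1 + n)) + ℓ)
        ≤ K * (1 / √(t + n)) / c * (2 * (J + 1) * (√(t + n) / M)) := by gcongr
      _ = 2 * K * (J + 1) / (c * M) := by field_simp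
      _ ≤ γ₀ / 4 := by
        rw [div_le_iff₀ (by positivity)]
        linarith
  have hev := hconf h hf hγ₀ hγ₀' hd hθs hinit hδ hn0 (by linarith : 0 ≤ ℓ)
    (log_one_div_le hd1 hδ) (fun t ht => by positivity) hσs
    (fun t ht => by have := hN0 t ht; positivity)
    (fun t ht => by
      have := ht1 ht
      have := hN0 1 le_rfl
      simp only [Nat.cast_one] at this ⊢
      gcongr)
    (fun t ht => by
      have := ht1 ht
      have h1 := hN0 t ht
      have h2 := hN0 (t + 1) (by omega)
      push_cast at h2 ⊢
      rw [mul_left_comm, ← mul_div_assoc 2]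
      refine mul_le_mul_of_nonneg_left ?_ hK0.le
      rw [div_le_div_iff₀ h1 h2, one_mul]
      refine Real.sqrt_le_iff.2 ⟨by positivity, ?_⟩
      rw [mul_pow, Real.sq_sqrt (by positivity)]
      linarith)
    (fun t ht => by
      have := ht1 ht
      push_cast
      have h1 := mul_le_mul_of_nonneg_left (one_sub_inv_mul_inv_sqrt_le (by linarith : 1 ≤ t + n))
        hK0.le
      calc K * (1 / √(t + n)) * (1 - 1 / (t + n)) = K * ((1 - 1 / (t + n)) / √(t + n)) := by ring
        _ ≤ K * (1 / √(t + n + 1)) := h1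
        _ = _ := by rw [add_right_comm])
    (fun t ht => by
      have h1 := hN0 t ht
      have h2 : √(t + n) ^ 2 = t + n := Real.sq_sqrt (by positivity)
      have hN : (t : ℝ) + n ≠ 0 := by rw [← h2]; positivity
      calc K * (1 / √(t + n)) * (s * √(d / √(t + n))) ^ 2
          = K * s ^ 2 * (d / √(t + n) ^ 2) := by rw [hσsq]; field_simp
        _ = 2 / γ₁ ^ 2 * (d / (t + n)) := by rw [h2, hK]; field_simp)
    hsmall hT
  refine hev.trans (measureReal_mono fun ω hω => ?_)
  rw [mem_ofPred_eq]
  have hT1 := ht1 hT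
  set Λ := Real.log (Real.exp 1 + d * T / δ) with hΛ
  have hℓΛ : ℓ ≤ Λ := log_exp_one_add_mono (by positivity)
    (by gcongr; exact le_mul_of_one_le_right hd0.le hT1)
  have hΛ1 : 1 ≤ Λ := hℓ1.trans hℓΛ
  have hn1 : √(1 + n) ≤ (1 + M) * (d * Λ) := by
    have h1 : d * ℓ ≤ d * Λ := by gcongr
    have h2 : 1 ≤ d * Λ := one_le_mul_of_one_le_of_one_le hd1 hΛ1
    have h3 : M * d * ℓ ≤ M * (d * Λ) := by rw [mul_assoc]; gcongr
    have h4 : n ≤ (M * (d * Λ)) ^ 2 := by rw [hn]; gcongr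
    refine Real.sqrt_le_iff.2 ⟨by positivity, ?_⟩
    nlinarith [mul_nonneg (by linarith : 0 ≤ M) (sq_nonneg (d * Λ))]
  have hterm (t : ℕ) (ht : 1 ≤ t) (htT : t ≤ T) : 1 - γ₀ ≤ inner ℝ θs (θ t ω) ∧
      1 - inner ℝ θs (θ t ω) ≤ P * (d * Λ) * (1 / √(t : ℝ)) := by
    have ht' := ht1 ht
    have hN := hN0 t ht
    have hω' := hω t ht htT
    have h1N := hN0 1 le_rfl
    have hratio : K * (1 / √(t + n)) / (K * (1 / √((1 : ℕ) + n))) = √(1 + n) / √(t + n) := by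
      push_cast at h1N ⊢
      field_simp
    rw [hratio] at hω'
    have hle1 : √(1 + n) / √(t + n) ≤ 1 :=
      div_le_one_of_le₀ (Real.sqrt_le_sqrt (by linarith)) hN.le
    have hnear : 1 - γ₀ ≤ inner ℝ θs (θ t ω) := by
      have h2 := mul_le_mul_of_nonneg_right hle1 (by linarith : 0 ≤ γ₀ / 4)
      have h3 := hsmall t ht
      linarith
    have hlogt : Real.log ((t + n) / (1 + n)) ≤ Λ :=
      ((log_shift_ratio_le ht' hn0).trans (Real.log_le_log (by linarith)
        (by exact_mod_cast htT))).trans (log_le_log_exp_one_add hd1 hδ hδ1 hT1)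
    have hsum : J * d * Real.log ((t + n) / (1 + n)) + ℓ ≤ (J + 1) * (d * Λ) := by
      have h2 : J * d * Real.log ((t + n) / (1 + n)) ≤ J * d * Λ := by gcongr
      have h3 : ℓ ≤ d * Λ := hℓΛ.trans (le_mul_of_one_le_left (by linarith) hd1)
      linarith
    have hbound := confidence_bound_le (g := γ₀ / 4) (K := K) (c := c) (by linarith) hK0.le hc.le
      (by positivity) hJ.le (by positivity : 0 ≤ d * Λ) (Real.sqrt_pos.2 (by linarith : (0 : ℝ) < t))
      (Real.sqrt_le_sqrt (by linarith : (t : ℝ) ≤ t + n)) hn1 hsum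
    rw [← hP] at hbound
    exact ⟨hnear, hω'.trans hbound⟩
  calc ∑ t ∈ Finset.Icc 1 T, (f 1 - f (inner ℝ θs (θ t ω)))
      ≤ 2 * γ₂ * (P * (d * Λ)) * √(T : ℝ) :=
        hf.sum_sub_le hγ₀' hγ₂.le (by positivity) fun t ht htT =>
          ⟨(hterm t ht htT).1, h.inner_le_one hθs ht ω, (hterm t ht htT).2⟩
    _ = 2 * γ₂ * P * Λ * (d * √(T : ℝ)) := by ring
    _ ≤ C * polylog 2 (d * T / δ) * (d * √(T : ℝ)) := by
      have h2 : Λ ≤ polylog 2 (d * T / δ) := le_self_pow₀ hΛ1 two_ne_zero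
      have h3 : 2 * γ₂ * P ≤ C := by linarith
      gcongr

theorem theorem1 (γ₀ γ₁ γ₂ : ℝ) (hγ₀ : 0 < γ₀) (hγ₀' : γ₀ ≤ 1 / 10) (hγ₁ : 0 < γ₁)
    (hγ₂ : 0 < γ₂) :
    -- pure exploration
    (∃ (s C : ℝ) (k : ℕ), 0 < s ∧ s ≤ 1 ∧ 0 < C ∧
      ∀ d : ℕ, 2 ≤ d → ∀ δ : ℝ, 0 < δ →
        ∃ η : ℕ → ℝ,
          (∀ t : ℕ, 1 ≤ t →
            ThetaWithin C (polylog k (d * t / δ)) (η t) (min ((d : ℝ) / t) (1 / d))) ∧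
          ∀ f : ℝ → ℝ, IsLink γ₀ γ₁ γ₂ f →
          ∀ θs : EuclideanSpace ℝ (Fin d), ‖θs‖ = 1 →
          ∀ (Ω : Type*) [mΩ : MeasurableSpace Ω] (μ : Measure Ω) [IsProbabilityMeasure μ]
            (𝓕 : Filtration ℕ mΩ) (θ Z : ℕ → Ω → EuclideanSpace ℝ (Fin d)) (ξ : ℕ → Ω → ℝ),
          IsInteractiveSGD μ 𝓕 f θs η (fun _ => s) θ Z ξ →
          (∀ᵐ ω ∂μ, 1 - γ₀ / 4 ≤ inner ℝ θs (θ 1 ω)) →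
          ∀ ε : ℝ, 0 < ε →
          ∀ T : ℕ, 1 ≤ T → C * polylog k (d / (ε * δ)) * ((d : ℝ) ^ 2 / ε) ≤ T →
            1 - δ * T ≤ μ.real {ω | 1 - ε ≤ inner ℝ θs (θ T ω)}) ∧
    -- regret minimization
    (∃ (C : ℝ) (k : ℕ), 0 < C ∧
      ∀ d : ℕ, 2 ≤ d → ∀ δ : ℝ, 0 < δ →
        ∃ η σ : ℕ → ℝ,
          (∀ t : ℕ, 1 ≤ t →
            ThetaWithin C (polylog k (d * t / δ)) (η t) (min (1 / √(t : ℝ)) (1 / d))) ∧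
          (∀ t : ℕ, 1 ≤ t → 0 ≤ σ t ∧ σ t ≤ 1 ∧
            ThetaWithin C (polylog k (d * t / δ)) (σ t ^ 2) (min ((d : ℝ) / √(t : ℝ)) 1)) ∧
          ∀ f : ℝ → ℝ, IsLink γ₀ γ₁ γ₂ f →
          ∀ θs : EuclideanSpace ℝ (Fin d), ‖θs‖ = 1 →
          ∀ (Ω : Type*) [mΩ : MeasurableSpace Ω] (μ : Measure Ω) [IsProbabilityMeasure μ]
            (𝓕 : Filtration ℕ mΩ) (θ Z : ℕ → Ω → EuclideanSpace ℝ (Fin d)) (ξ : ℕ → Ω → ℝ),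
          IsInteractiveSGD μ 𝓕 f θs η σ θ Z ξ →
          (∀ᵐ ω ∂μ, 1 - γ₀ / 4 ≤ inner ℝ θs (θ 1 ω)) →
          ∀ T : ℕ, 1 ≤ T →
            1 - δ * T ≤ μ.real {ω | ∑ t ∈ Finset.Icc 1 T, (f 1 - f (inner ℝ θs (θ t ω)))
              ≤ C * polylog k (d * T / δ) * (d * √(T : ℝ))}) := by
  exact ⟨pure_exploration hγ₀ hγ₀' hγ₁ hγ₂, regret_minimization hγ₀ hγ₀' hγ₁ hγ₂⟩
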